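/- Let $G$ be a finite abelian group (written additively) of order $n$, and let $S$ be a sequence over $G$ of length $n$, i.e. a finite multiset of $n$ elements of $G$, where $a^k b^l$ denotes the sequence consisting of $k$ copies of $a$ and $l$ copies of $b$. Suppose that there is a unique $r\in[1,n]$ such that $S$ has a zero-sum subsequence of length $r$ (that is, all nonempty zero-sum subsequences of $S$ have the same length $r$). Then $S$ has at most two distinct terms. Moreover: (a) If $G$ is not cyclic, then there are an integer $m\ge 1$ and elements $g,h\in G$ with $h\notin\langle g\rangle$, $\mathrm{ord}(g)=\frac n2$ and $\mathrm{ord}(h)=2$ such that $G=\langle h\rangle\oplus\langle g\rangle\cong C_2\oplus C_{2m}$, $r=\frac n2=2m$, and $$S=g^{n-1}g'\quad\text{or}\quad S=g^{n/2+x}(h+g)^{n/2-x}\quad\text{or}\quad S=g^{n/2+x}\left(h+\tfrac{n+4}{4}g\right)^{n/2-x}$$ for some $g'\in G\setminus\langle g\rangle$, respectively some odd $x\in[1,\frac n2-1]$. (b) If $G$ is cyclic, then there is a generator $g$ of $G$ such that at least one of the following holds: (i) $S=g^{n-1}g'$ for some $g'\in G$; (ii) $S=(2g)^{n-1}g''$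 for some $g''\in G\setminus\langle 2g\rangle$; (iii) $n$ is odd, $r=\frac{n+1}{2}$ and $S=g^{n-2}\left(\frac{n+1}{2}g\right)^2$; (iv) $n\equiv 2 \pmod 4$, $r=\frac n2$ and $S=(2g)^{n/2+x}\left(\frac{n+4}{2}g\right)^{n/2-x}$ for some even $x\in[0,\frac n2-1]$; (v) $n$ is even, $r=\frac n2$ and $S=g^{n/2+x}\left(\frac{n+2}{2}g\right)^{n/2-x}$ for some $x\in[0,\frac n2-1]$ with $\frac n2-x$ odd. -/

import Mathlib

/-- Sequences over `G` (elements of the free abelian monoid with basis `G`) are multisets over `G`;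
a subsequence of `S` is a multiset `T ≤ S`. `subseqSums k S` is the set `Σ_k(S)` of the sums of
all subsequences of `S` of length `k`. -/
def subseqSums {G : Type*} [AddCommGroup G] (k : ℕ) (S : Multiset G) : Set G :=
  {a | ∃ T : Multiset G, T ≤ S ∧ Multiset.card T = k ∧ T.sum = a}

/-- The support of a sequence: the set of its distinct terms. -/
def seqSupp {G : Type*} (S : Multiset G) : Set G := {a | a ∈ S}

/-- The sequence `a ^ k * b ^ l` in multiplicative notation: `k` copies of `a`, `l` copies of `b`. -/
def twoTermSeq {G : Type*} (a : G) (k : ℕ) (b : G) (l : ℕ) : Multiset G :=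
  Multiset.replicate k a + Multiset.replicate l b

/-! Let W be a longest zero-sum free subsequence of S and T a zero-sum subsequence, of length r. The
complement of T is zero-sum free, since a zero-sum part of it would lengthen T; hence n - r ≤ |W|.
Also r ≤ |W| or |W| = n - 1: otherwise, exchanging a term of T for a term outside T leaves a
sequence that must again be zero-sum, so all terms of S agree and S itself is zero-sum, of the wrong
length.

Three cases remain. If |W| = n - 1, then W is constant. If 2|W| > n, the Savchev–Chen theorem
(`ZeroSumFree.exists_eq_map_nsmul`) writes W as multiples of one element g with coefficient sum
below ord(g), which forces ord(g) = n. The problem then concerns residues modulo n, and trading a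
residue x for x copies of 1 changes lengths while keeping sums, which leaves very few sequences
(`ZeroSumConfig`).

Otherwise |W| = r = n/2 (`BalancedConfig`). Put s = σ(S), which is nonzero. Any r + 1 terms contain
a zero-sum subsequence of length r, so exactly one term is dropped and its value is known. In
particular T + s lies in the complement of T. If 2s ≠ 0, a double exchange shows that T is constant
and S = x^(2r-1) u. If 2s = 0, passing to G/⟨s⟩ shows that S has only the terms x and x + s.
Determining the order of x then gives the lists (a) and (b). -/

/-- A sequence is zero-sum free if it has no nonempty zero-sum subsequence. -/
def ZeroSumFree {G : Type*} [AddCommGroup G] (S : Multiset G) : Prop :=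
  ∀ T ≤ S, T.sum = 0 → T = 0

/-- The finite set of the sums of all (possibly empty) subsequences. -/
def subsums {G : Type*} [AddCommGroup G] [DecidableEq G] (S : Multiset G) : Finset G :=
  (S.powerset.map Multiset.sum).toFinset

section ZeroSumFree

variable {G : Type*} [AddCommGroup G]

theorem ZeroSumFree.mono {S T : Multiset G} (hT : ZeroSumFree T) (h : S ≤ T) : ZeroSumFree S :=
  fun U hU => hT U (hU.trans h)

theorem ZeroSumFree.ne_zero {S : Multiset G} (hS : ZeroSumFree S) {b : G} (hb : b ∈ S) :
    b ≠ 0 := by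
  rintro rfl
  have := hS {0} (by simpa using hb) (by simp)
  simp at this

theorem ZeroSumFree.card_lt_addOrderOf [Finite G] {b : G} {l : ℕ}
    (h : ZeroSumFree (Multiset.replicate l b)) : l < addOrderOf b := by
  by_contra! hl
  have := h (Multiset.replicate (addOrderOf b) b)
    ((Multiset.replicate_le_replicate b).2 hl) (by simp [addOrderOf_nsmul_eq_zero])
  have h2 := congrArg Multiset.card this
  simp only [Multiset.card_replicate, Multiset.card_zero] at h2
  exact (addOrderOf_pos b).ne' h2

end ZeroSumFree

/-! ### Subset sums and the Savchev–Chen structure theorem -/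

section Subsums

variable {G : Type*} [AddCommGroup G] [DecidableEq G]

theorem mem_subsums {S : Multiset G} {a : G} : a ∈ subsums S ↔ ∃ T ≤ S, T.sum = a := by
  simp [subsums]

theorem subsums_mono {S T : Multiset G} (h : S ≤ T) : subsums S ⊆ subsums T := by
  intro a ha
  obtain ⟨U, hU, rfl⟩ := mem_subsums.1 ha
  exact mem_subsums.2 ⟨U, hU.trans h, rfl⟩

theorem sum_mem_subsums (S : Multiset G) : S.sum ∈ subsums S :=
  mem_subsums.2 ⟨S, le_rfl, rfl⟩

theorem add_mem_subsums_of_mem_erase {S : Multiset G} {b a : G} (hb : b ∈ S)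
    (ha : a ∈ subsums (S.erase b)) : b + a ∈ subsums S := by
  obtain ⟨U, hU, rfl⟩ := mem_subsums.1 ha
  refine mem_subsums.2 ⟨b ::ₘ U, ?_, by simp⟩
  rw [← Multiset.cons_erase hb]
  exact Multiset.cons_le_cons _ hU

theorem mem_subsums_iff_erase {S : Multiset G} {b a : G} (hb : b ∈ S) :
    a ∈ subsums S ↔ a ∈ subsums (S.erase b) ∨ a - b ∈ subsums (S.erase b) := by
  constructor
  · intro ha
    obtain ⟨U, hU, rfl⟩ := mem_subsums.1 ha
    by_cases hbU : b ∈ U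
    · right
      refine mem_subsums.2 ⟨U.erase b, Multiset.erase_le_erase _ hU, ?_⟩
      rw [eq_sub_iff_add_eq, add_comm, Multiset.sum_erase hbU]
    · left
      refine mem_subsums.2 ⟨U, ?_, rfl⟩
      rw [← Multiset.erase_of_notMem hbU]
      exact Multiset.erase_le_erase _ hU
  · rintro (h | h)
    · exact subsums_mono (Multiset.erase_le _ _) h
    · simpa using add_mem_subsums_of_mem_erase hb h

theorem sub_mem_subsums {S : Multiset G} {a : G} (ha : a ∈ subsums S) :
    S.sum - a ∈ subsums S := by
  obtain ⟨U, hU, rfl⟩ := mem_subsums.1 ha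
  refine mem_subsums.2 ⟨S - U, tsub_le_self, ?_⟩
  rw [eq_sub_iff_add_eq, ← Multiset.sum_add, tsub_add_cancel_of_le hU]

theorem ZeroSumFree.neg_notMem {S : Multiset G} (hS : ZeroSumFree S) {b : G} (hb : b ∈ S) :
    -b ∉ subsums (S.erase b) := by
  intro h
  obtain ⟨U, hU, hs⟩ := mem_subsums.1 h
  have hle : b ::ₘ U ≤ S := by
    rw [← Multiset.cons_erase hb]
    exact Multiset.cons_le_cons _ hU
  have := hS _ hle (by simp [hs])
  simp at this

/-- Taking complements inside `S.erase b` turns the full sum into `-b`, which together with `b`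
would be a zero-sum subsequence. -/
theorem ZeroSumFree.sum_notMem {S : Multiset G} (hS : ZeroSumFree S) {b : G} (hb : b ∈ S) :
    S.sum ∉ subsums (S.erase b) := by
  intro h
  have := sub_mem_subsums h
  rw [show (S.erase b).sum = S.sum - b by
    rw [eq_sub_iff_add_eq, add_comm, Multiset.sum_erase hb]] at this
  exact hS.neg_notMem hb (by simpa using this)

theorem subsums_replicate (l : ℕ) (b : G) :
    subsums (Multiset.replicate l b) = (Finset.range (l + 1)).image (· • b) := by
  ext a
  simp only [mem_subsums, Finset.mem_image, Finset.mem_range, Multiset.le_replicate_iff]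
  constructor
  · rintro ⟨T, ⟨i, hi, rfl⟩, rfl⟩
    exact ⟨i, by omega, by simp⟩
  · rintro ⟨i, hi, rfl⟩
    exact ⟨Multiset.replicate i b, ⟨i, by omega, rfl⟩, by simp⟩

theorem card_le_sum_of_one_le {L : Multiset ℕ} (h : ∀ x ∈ L, 1 ≤ x) :
    Multiset.card L ≤ L.sum := by
  simpa using Multiset.card_nsmul_le_sum h

/-- If removing any single term of a zero-sum free sequence with few subsums loses only one
subsum, then all terms are equal. -/
theorem ZeroSumFree.eq_of_card_subsums_erase {S : Multiset G} (hS : ZeroSumFree S)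
    (h : ∀ b ∈ S, (subsums S).card ≤ (subsums (S.erase b)).card + 1) {b c : G} (hb : b ∈ S)
    (hc : c ∈ S) : b = c := by
  have key : ∀ b ∈ S, subsums (S.erase b) = (subsums S).erase S.sum := by
    intro b hb
    apply Finset.eq_of_subset_of_card_le
    · intro a ha
      refine Finset.mem_erase.2 ⟨?_, subsums_mono (Multiset.erase_le _ _) ha⟩
      rintro rfl
      exact hS.sum_notMem hb ha
    · rw [Finset.card_erase_of_mem (sum_mem_subsums S)]
      have := h b hb
      omega
  have hsum : ∀ b ∈ S, (S.erase b).sum = S.sum - b := fun b hb => by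
    rw [eq_sub_iff_add_eq, add_comm, Multiset.sum_erase hb]
  -- The set E = Σ(S) \ {σ(S)} equals Σ(S - b) for every term b, so it is symmetric under a ↦ σ(S) -
  -- b - a. Composing two such reflections gives translation by b - c.
  have inv : ∀ b ∈ S, ∀ c ∈ S, ∀ y ∈ (subsums S).erase S.sum,
      y + (b - c) ∈ (subsums S).erase S.sum := by
    intro b hb c hc y hy
    rw [← key b hb] at hy
    have h1 := sub_mem_subsums hy
    rw [key b hb, ← key c hc] at h1
    have h2 := sub_mem_subsums h1
    rw [hsum b hb, hsum c hc, key c hc] at h2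
    convert h2 using 1
    abel
  by_contra hne
  have h1 : S.sum - b ∈ (subsums S).erase S.sum := by
    rw [← key b hb, ← hsum b hb]
    exact sum_mem_subsums _
  have h2 := inv b hb c hc _ h1
  rw [← key b hb] at h2
  have h3 := add_mem_subsums_of_mem_erase hb h2
  -- The element σ(S) + (b - c) lies in E when b ≠ c; translating it back by c - b would put σ(S) in
  -- E.
  have h4 : b + (S.sum - b + (b - c)) ∈ (subsums S).erase S.sum := by
    refine Finset.mem_erase.2 ⟨fun h => hne ?_, h3⟩
    have : b - c = 0 := by
      have h5 : b + (S.sum - b + (b - c)) = S.sum + (b - c) := by abel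
      rw [h5] at h
      simpa using h
    exact sub_eq_zero.1 this
  have h5 := inv c hc b hb _ h4
  rw [show b + (S.sum - b + (b - c)) + (c - b) = S.sum by abel] at h5
  simp at h5

/-- **Savchev–Chen structure theorem**, in terms of the number of subsums. -/
theorem ZeroSumFree.exists_eq_map_nsmul [Finite G] {S : Multiset G} (hS : ZeroSumFree S)
    (hc : (subsums S).card + 1 ≤ 2 * Multiset.card S) :
    ∃ (g : G) (L : Multiset ℕ), S = L.map (· • g) ∧ (∀ x ∈ L, 1 ≤ x) ∧
      L.sum < addOrderOf g ∧ subsums S = (Finset.range (L.sum + 1)).image (· • g) := by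
  induction hl : Multiset.card S generalizing S with
  | zero => omega
  | succ l ih =>
  by_cases hex : ∃ b ∈ S, (subsums (S.erase b)).card + 1 ≤ 2 * l
  · obtain ⟨b, hb, hbc⟩ := hex
    have hcard : Multiset.card (S.erase b) = l := by
      rw [Multiset.card_erase_of_mem hb, hl]; rfl
    obtain ⟨g, L, hL, hL1, hLs, hsub⟩ :=
      ih (hS.mono (Multiset.erase_le b S)) (by rw [hcard]; exact hbc) hcard
    have hlen : Multiset.card L = l := by rw [← hcard, hL, Multiset.card_map]
    have hP := card_le_sum_of_one_le hL1
    have hmem : ∀ a, a ∈ subsums (S.erase b) ↔ ∃ i < L.sum + 1, i • g = a := by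
      intro a; rw [hsub]; simp
    have hneg := hS.neg_notMem hb
    -- The subsums of S - b form the interval {0, ..., ΣL}·g. A multiple x·g with x ≤ ΣL + 1 extends
    -- it without a gap.
    by_cases hx : ∃ x, 1 ≤ x ∧ x ≤ L.sum + 1 ∧ b = x • g
    · obtain ⟨x, hx1, hx2, rfl⟩ := hx
      have hlt : x + L.sum < addOrderOf g := by
        by_contra! hcon
        apply hneg
        rw [hmem]
        refine ⟨addOrderOf g - x, by omega, ?_⟩
        rw [eq_neg_iff_add_eq_zero, ← add_nsmul, Nat.sub_add_cancel (by omega),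
          addOrderOf_nsmul_eq_zero]
      refine ⟨g, x ::ₘ L, ?_, ?_, by simpa using hlt, ?_⟩
      · rw [Multiset.map_cons, ← hL, Multiset.cons_erase hb]
      · intro y hy
        rcases Multiset.mem_cons.1 hy with rfl | hy
        · exact hx1
        · exact hL1 y hy
      · ext a
        rw [mem_subsums_iff_erase hb, hmem, hmem]
        simp only [Multiset.sum_cons, Finset.mem_image, Finset.mem_range]
        constructor
        · rintro (⟨i, hi, rfl⟩ | ⟨i, hi, h⟩)
          · exact ⟨i, by omega, rfl⟩
          · exact ⟨i + x, by omega, by rw [add_nsmul, h]; abel⟩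
        · rintro ⟨i, hi, rfl⟩
          by_cases hi2 : i < L.sum + 1
          · exact Or.inl ⟨i, hi2, rfl⟩
          · refine Or.inr ⟨i - x, by omega, ?_⟩
            rw [eq_sub_iff_add_eq, ← add_nsmul, Nat.sub_add_cancel (by omega)]
    · exfalso
      push Not at hx
      -- Otherwise the interval and its translate by b are disjoint, giving at least 2(l + 1)
      -- subsums, one more than allowed.
      have hdisj : Disjoint (subsums (S.erase b)) ((subsums (S.erase b)).image (b + ·)) := by
        rw [Finset.disjoint_left]
        intro a ha ha2
        obtain ⟨c, hc', rfl⟩ := Finset.mem_image.1 ha2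
        obtain ⟨j, hj, hj2⟩ := (hmem _).1 ha
        obtain ⟨i, hi, rfl⟩ := (hmem _).1 hc'
        rcases lt_trichotomy i j with hij | rfl | hij
        · refine hx (j - i) (by omega) (by omega) ?_
          rw [sub_nsmul g hij.le, hj2]; abel
        · exact hS.ne_zero hb (by simpa using hj2)
        · apply hneg
          rw [hmem]
          refine ⟨i - j, by omega, ?_⟩
          rw [sub_nsmul g hij.le, hj2]; abel
      have hsubset : subsums (S.erase b) ∪ (subsums (S.erase b)).image (b + ·) ⊆ subsums S := by
        intro a ha
        rw [mem_subsums_iff_erase hb]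
        rcases Finset.mem_union.1 ha with h | h
        · exact Or.inl h
        · obtain ⟨c, hc', rfl⟩ := Finset.mem_image.1 h
          right; simpa using hc'
      have h1 := Finset.card_le_card hsubset
      rw [Finset.card_union_of_disjoint hdisj,
        Finset.card_image_of_injective _ (add_right_injective b)] at h1
      have h2 : (subsums (S.erase b)).card = L.sum + 1 := by
        rw [hsub, Finset.card_image_of_injOn, Finset.card_range]
        intro i hi j hj hij
        simp only [Finset.coe_range, Set.mem_Iio] at hi hj
        exact nsmul_injOn_Iio_addOrderOf (by simp; omega) (by simp; omega) hij
      omega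
  · push Not at hex
    -- Here every removal leaves at least 2l subsums out of at most 2l + 1, so each loses at most
    -- one.
    have hconst : ∀ b ∈ S, ∀ c ∈ S, b = c := fun b hb c hc' =>
      hS.eq_of_card_subsums_erase (fun b hb => by have := hex b hb; omega) hb hc'
    obtain ⟨b, hb⟩ := Multiset.card_pos_iff_exists_mem.1 (by omega : 0 < Multiset.card S)
    have hrep : S = Multiset.replicate (l + 1) b :=
      Multiset.eq_replicate.2 ⟨hl, fun c hc' => hconst c hc' b hb⟩
    refine ⟨b, Multiset.replicate (l + 1) 1, by simpa using hrep, ?_, ?_, ?_⟩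
    · intro x hx; rw [Multiset.eq_of_mem_replicate hx]
    · rw [hrep] at hS
      simpa [add_comm] using hS.card_lt_addOrderOf
    · rw [hrep, subsums_replicate]; simp [add_comm]

theorem card_subsums_le [Finite G] (S : Multiset G) : (subsums S).card ≤ Nat.card G := by
  have := Fintype.ofFinite G
  rw [Nat.card_eq_fintype_card]
  exact Finset.card_le_univ _

/-- The bound D(G) ≤ |G| on the Davenport constant: at length |G| the structure theorem applies and
gives |G| ≤ ΣL < ord(g). -/
theorem ZeroSumFree.card_lt [Finite G] {S : Multiset G} (hS : ZeroSumFree S) :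
    Multiset.card S < Nat.card G := by
  by_contra! h
  have h0 := Nat.card_pos (α := G)
  obtain ⟨g, L, rfl, hL1, hL, -⟩ := hS.exists_eq_map_nsmul (by
    have := card_subsums_le S; omega)
  have := card_le_sum_of_one_le hL1
  have := addOrderOf_le_card (x := g)
  rw [Multiset.card_map] at h
  omega

/-- Here ΣL < ord(g) ≤ |L| + 1, so every coefficient is 1. Length at least 2 is what makes |G| + 1 ≤
2|S|. -/
theorem ZeroSumFree.eq_replicate_of_card [Finite G] {S : Multiset G} (hS : ZeroSumFree S)
    (h : Multiset.card S + 1 = Nat.card G) (h2 : 2 ≤ Multiset.card S) :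
    ∃ g : G, S = Multiset.replicate (Multiset.card S) g ∧ addOrderOf g = Nat.card G := by
  obtain ⟨g, L, hSL, hL1, hL, -⟩ := hS.exists_eq_map_nsmul (by
    have := card_subsums_le S; omega)
  have h3 := card_le_sum_of_one_le hL1
  have h4 := addOrderOf_le_card (x := g)
  have h5 : Multiset.card S = Multiset.card L := by rw [hSL, Multiset.card_map]
  refine ⟨g, ?_, by omega⟩
  rw [Multiset.eq_replicate]
  refine ⟨rfl, fun b hb => ?_⟩
  rw [hSL] at hb
  obtain ⟨x, hx, rfl⟩ := Multiset.mem_map.1 hb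
  have h6 : x = 1 := by
    have h7 := hL1 x hx
    have h8 : Multiset.card (L.erase x) ≤ (L.erase x).sum :=
      card_le_sum_of_one_le fun y hy => hL1 y (Multiset.mem_of_mem_erase hy)
    rw [Multiset.card_erase_of_mem hx] at h8
    have h9 := Multiset.sum_erase hx
    have : 0 < Multiset.card L := Multiset.card_pos_iff_exists_mem.2 ⟨x, hx⟩
    simp only [Nat.pred_eq_sub_one] at h8
    omega
  simp [h6]

end Subsums

/-! ### Residues modulo n with a long zero-sum free part -/

/-- A sequence `1 ^ k * X * Y` of `n` residues modulo `n`, written with natural numbers, such that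
`1 ^ k * X` is long and of sum less than `n`, it cannot be extended by a term of `Y` without
creating a zero-sum subsequence, and all nonempty zero-sum subsequences have length `r`. -/
structure ZeroSumConfig (n r k : ℕ) (X Y : Multiset ℕ) : Prop where
  two_le : ∀ x ∈ X, 2 ≤ x
  sum_lt : k + X.sum < n
  card_eq : k + Multiset.card X + Multiset.card Y = n
  lt_card : n + 1 ≤ 2 * (k + Multiset.card X)
  two_le_card : 2 ≤ Multiset.card Y
  card_le : Multiset.card Y ≤ r
  le_card : r ≤ k + Multiset.card X
  exists_rep : ∀ y ∈ Y, ∃ j ≤ k, ∃ I ≤ X, j + I.sum + y = n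
  card_of_dvd : ∀ i ≤ k, ∀ X' ≤ X, ∀ Y' ≤ Y, n ∣ i + X'.sum + Y'.sum →
    0 < i + Multiset.card X' + Multiset.card Y' →
    i + Multiset.card X' + Multiset.card Y' = r

theorem Multiset.exists_pair_le {α : Type*} [DecidableEq α] {Y : Multiset α} {y : α} (hy : y ∈ Y)
    (h : 2 ≤ Multiset.card Y) : ∃ z ∈ Y, ({y, z} : Multiset α) ≤ Y := by
  have h1 : 0 < Multiset.card (Y.erase y) := by
    rw [Multiset.card_erase_of_mem hy, Nat.pred_eq_sub_one]; omega
  obtain ⟨z, hz⟩ := Multiset.card_pos_iff_exists_mem.1 h1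
  refine ⟨z, Multiset.mem_of_mem_erase hz, ?_⟩
  rw [← Multiset.cons_erase hy, Multiset.insert_eq_cons]
  exact Multiset.cons_le_cons _ (by simpa using hz)

namespace ZeroSumConfig

variable {n r k : ℕ} {X Y : Multiset ℕ}

theorem two_mul_card_le (h : ZeroSumConfig n r k X Y) {I : Multiset ℕ} (hI : I ≤ X) :
    2 * Multiset.card I ≤ I.sum := by
  have := Multiset.card_nsmul_le_sum (s := I) (a := 2)
    fun x hx => h.two_le x (Multiset.mem_of_le hI hx)
  simpa [mul_comm] using this

theorem card_rep (h : ZeroSumConfig n r k X Y) {y j : ℕ} {I : Multiset ℕ} (hy : y ∈ Y)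
    (hj : j ≤ k) (hI : I ≤ X) (hs : j + I.sum + y = n) : j + Multiset.card I + 1 = r := by
  have := h.card_of_dvd j hj I hI {y} (by simpa using hy) (by simp [hs]) (by simp)
  simpa using this

theorem card_pair (h : ZeroSumConfig n r k X Y) {y z j : ℕ} {I : Multiset ℕ}
    (hy : ({y, z} : Multiset ℕ) ≤ Y) (hj : j ≤ k) (hI : I ≤ X) (hs : n ∣ j + I.sum + (y + z)) :
    j + Multiset.card I + 2 = r := by
  have := h.card_of_dvd j hj I hI {y, z} hy (by simpa using hs) (by simp)
  simpa using this

/-- The other terms of X are at least 2, while the total is below n ≤ 2(k + |X|) - 1; this makes x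
replaceable by ones. -/
theorem le_of_mem (h : ZeroSumConfig n r k X Y) {x : ℕ} (hx : x ∈ X) : x ≤ k := by
  have h1 := h.two_mul_card_le (Multiset.erase_le x X)
  have h2 := Multiset.sum_erase hx
  have h3 := Multiset.card_erase_add_one hx
  have := h.sum_lt
  have := h.lt_card
  omega

/-- If enough ones were unused, x could be replaced by x ones: same sum, different length. -/
theorem lt_add_of_mem_rep (h : ZeroSumConfig n r k X Y) {y j x : ℕ} {I : Multiset ℕ} (hy : y ∈ Y)
    (hj : j ≤ k) (hI : I ≤ X) (hs : j + I.sum + y = n) (hx : x ∈ I) : k < j + x := by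
  by_contra! hcon
  have h1 := h.card_rep hy hj hI hs
  have h2 := Multiset.sum_erase hx
  have h3 := Multiset.card_erase_add_one hx
  have h4 := h.card_rep hy hcon ((Multiset.erase_le x I).trans hI) (by omega)
  have := h.two_le x (Multiset.mem_of_le hI hx)
  omega

/-- The reverse trade: x of the j ones could be replaced by the unused term x. -/
theorem lt_of_mem_sub_rep (h : ZeroSumConfig n r k X Y) {y j x : ℕ} {I : Multiset ℕ} (hy : y ∈ Y)
    (hj : j ≤ k) (hI : I ≤ X) (hs : j + I.sum + y = n) (hx : x ∈ X - I) : j < x := by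
  by_contra! hcon
  have h1 := h.card_rep hy hj hI hs
  have hle : x ::ₘ I ≤ X := by
    rw [← tsub_add_cancel_of_le hI, ← Multiset.singleton_add]
    exact add_le_add_left (by simpa using hx) _
  have h4 := h.card_rep (j := j - x) hy (by omega) hle (by rw [Multiset.sum_cons]; omega)
  have := h.two_le x (Multiset.mem_of_le tsub_le_self hx)
  rw [Multiset.card_cons] at h4
  omega

theorem two_terms_of_eq_zero (h : ZeroSumConfig n r k 0 Y) :
    (k = n - 2 ∧ Y = Multiset.replicate 2 ((n + 1) / 2) ∧ Odd n ∧ r = (n + 1) / 2) ∨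
      (n = 2 * r ∧ r < k ∧ Odd (n - k) ∧ Y = Multiset.replicate (n - k) ((n + 2) / 2)) := by
  obtain ⟨-, h1, h2, h3, h4, h5, h6, h7, h8⟩ := id h
  simp only [Multiset.card_zero, Multiset.sum_zero, add_zero] at h1 h2 h3 h6
  have hy : ∀ y ∈ Y, y + (r - 1) = n := by
    intro y hy
    obtain ⟨j, hj, I, hI, hs⟩ := h7 y hy
    have := h.card_rep hy hj hI hs
    obtain rfl : I = 0 := by simpa using hI
    simp only [Multiset.card_zero, Multiset.sum_zero] at *
    omega
  obtain ⟨y, hyn⟩ : ∃ y, y + (r - 1) = n := ⟨n - (r - 1), by omega⟩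
  have hY : Y = Multiset.replicate (n - k) y :=
    Multiset.eq_replicate.2 ⟨by omega, fun z hz => by have := hy z hz; omega⟩
  have hz : ∀ i ≤ k, ∀ j ≤ n - k, n ∣ i + j * y → 0 < i + j → i + j = r := by
    intro i hi j hj hd h0
    have := h8 i hi 0 le_rfl (Multiset.replicate j y)
      (by rw [hY]; exact (Multiset.replicate_le_replicate y).2 hj) (by simpa using hd)
      (by simpa using h0)
    simpa using this
  -- With y = n - (r - 1), the zero-sum subsequences with two or three copies of y, filled up by
  -- ones, have length different from r unless n and r are tightly related.
  have hA : k < 2 * (r - 1) := by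
    by_contra! hcon
    have := hz (2 * (r - 1)) hcon 2 (by omega) ⟨2, by omega⟩ (by omega)
    omega
  have hB : 2 * (r - 1) < n := by
    by_contra! hcon
    have := hz (2 * (r - 1) - n) (by omega) 2 (by omega) ⟨1, by omega⟩ (by omega)
    omega
  by_cases hm : n - k = 2
  · left
    have h9 : y = (n + 1) / 2 := by omega
    rw [hm, h9] at hY
    exact ⟨by omega, hY, by rw [Nat.odd_iff]; omega, by omega⟩
  · right
    have := hz (3 * (r - 1) - n) (by omega) 3 (by omega) ⟨2, by omega⟩ (by omega)
    have h9 : y = (n + 2) / 2 := by omega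
    rw [h9] at hY
    refine ⟨by omega, by omega, ?_, hY⟩
    by_contra hodd
    rw [Nat.not_odd_iff_even] at hodd
    obtain ⟨p, hp⟩ := hodd
    -- With y = r + 1 and an even number of copies, the whole sequence would be zero-sum, of length
    -- 2r.
    have := hz k le_rfl (n - k) le_rfl ⟨1 + p, by
      have e1 : y = r + 1 := by omega
      have e2 : k + (n - k) = n := by omega
      rw [e1, mul_add, mul_one, add_left_comm, e2, hp, show n = 2 * r by omega]
      ring⟩ (by omega)
    omega

/-- If y is completed by ones alone, every term of X exceeds j = r - 1, and counting forces X = {x}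
with x = r = |Y|. A second term of Y then gives a two-term completion of the wrong length. -/
theorem rep_ne_zero (h : ZeroSumConfig n r k X Y) (hX : X ≠ 0) {y j : ℕ} (hy : y ∈ Y)
    (hj : j ≤ k) : j + y ≠ n := by
  intro hs
  have hs0 : j + (0 : Multiset ℕ).sum + y = n := by simpa using hs
  have hr := h.card_rep hy hj (Multiset.zero_le X) hs0
  have hlt : ∀ x ∈ X, j < x := fun x hx =>
    h.lt_of_mem_sub_rep hy hj (Multiset.zero_le X) hs0 (by simpa using hx)
  obtain ⟨-, h1, h2, h3, h4, h5, h6, h7, -⟩ := id h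
  obtain ⟨x, hx⟩ := Multiset.exists_mem_of_ne_zero hX
  obtain ⟨X', rfl⟩ := Multiset.exists_cons_of_mem hx
  have hX' : X' = 0 := by
    by_contra hne
    obtain ⟨x', hx'⟩ := Multiset.exists_mem_of_ne_zero hne
    obtain ⟨X'', rfl⟩ := Multiset.exists_cons_of_mem hx'
    have e1 := hlt x hx
    have e2 := hlt x' (by simp)
    have e3 := h.two_mul_card_le (I := X'')
      ((Multiset.le_cons_self _ _).trans (Multiset.le_cons_self _ _))
    simp only [Multiset.card_cons, Multiset.sum_cons, Multiset.card_zero] at *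
    omega
  subst hX'
  have e1 := hlt x hx
  simp only [Multiset.card_cons, Multiset.sum_cons, Multiset.card_zero, Multiset.sum_zero] at *
  have hxk := h.le_of_mem hx
  obtain ⟨z, hz, hyz⟩ := Multiset.exists_pair_le hy h4
  obtain ⟨i, hi, I, hI, hs'⟩ := h7 z hz
  have hI' : I = 0 ∨ I = {x} := by
    simpa [Multiset.le_singleton] using hI
  have hr' := h.card_rep hz hi hI hs'
  rcases hI' with rfl | rfl
  · simp only [Multiset.card_zero, Multiset.sum_zero] at hr' hs'
    have := h.card_pair (j := Multiset.card Y - 2) (I := {x}) hyz (by omega) (by simp)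
      ⟨2, by simp only [Multiset.sum_singleton]; omega⟩
    simp only [Multiset.card_singleton] at this
    omega
  · simp only [Multiset.card_singleton, Multiset.sum_singleton] at hr' hs'
    by_cases hc : 2 * Multiset.card Y - 3 ≤ k
    · have := h.card_pair (j := 2 * Multiset.card Y - 3) (I := {x}) hyz (by omega) (by simp)
        ⟨2, by simp only [Multiset.sum_singleton]; omega⟩
      simp only [Multiset.card_singleton] at this
      omega
    · have := h.card_pair (j := 2 * Multiset.card Y - 4 - k) (I := 0) hyz (by omega) (by simp)
        ⟨1, by simp only [Multiset.sum_zero]; omega⟩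
      simp only [Multiset.card_zero] at this
      omega

/-- With a used and b unused, the trades give a > k - j and b > j. The sum bound then leaves almost
no slack, and swapping a for b forces j = 1 and all terms of X equal to 2. -/
theorem mixed_rep (h : ZeroSumConfig n r k X Y) {y j a b : ℕ} {I : Multiset ℕ} (hy : y ∈ Y)
    (hj : j ≤ k) (hI : I ≤ X) (hs : j + I.sum + y = n) (ha : a ∈ I) (hb : b ∈ X - I) :
    k = 2 ∧ n = 2 * Multiset.card X + 3 ∧ r = Multiset.card X + 1 ∧ 2 ≤ Multiset.card X ∧
      X = Multiset.replicate (Multiset.card X) 2 := by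
  have hr := h.card_rep hy hj hI hs
  have h1 := h.lt_add_of_mem_rep hy hj hI hs ha
  have h2 := h.lt_of_mem_sub_rep hy hj hI hs hb
  obtain ⟨I', rfl⟩ := Multiset.exists_cons_of_mem ha
  obtain ⟨J, hJ⟩ := Multiset.exists_cons_of_mem hb
  have hX : X = b ::ₘ J + a ::ₘ I' := by rw [← hJ, tsub_add_cancel_of_le hI]
  have hI'X : I' ≤ X := (Multiset.le_cons_self _ _).trans hI
  have hJX : J ≤ X := (Multiset.le_cons_self J b).trans (hJ ▸ tsub_le_self)
  have e1 := h.two_mul_card_le hI'X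
  have e2 := h.two_mul_card_le hJX
  obtain ⟨h0, h3, h4, h5, h6, h7, h8, -, -⟩ := id h
  have hbI : b ::ₘ I' ≤ X := by
    rw [hX, ← Multiset.singleton_add, ← Multiset.singleton_add b J,
      ← Multiset.singleton_add a I']
    exact add_le_add (Multiset.le_add_right _ _) (Multiset.le_add_left _ _)
  have hsum : X.sum = b + J.sum + (a + I'.sum) := by
    simp only [hX, Multiset.sum_add, Multiset.sum_cons]
  have hcard : Multiset.card X = Multiset.card J + 1 + (Multiset.card I' + 1) := by
    simp only [hX, Multiset.card_add, Multiset.card_cons]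
  have hb2 := h0 b (by simp [hX])
  have ha2 := h0 a (by simp [hX])
  rw [Multiset.sum_cons] at hs
  rw [Multiset.card_cons] at hr
  have hr2 := h.card_rep (j := j + a - b) hy (by omega) hbI (by rw [Multiset.sum_cons]; omega)
  rw [Multiset.card_cons] at hr2
  refine ⟨by omega, by omega, by omega, by omega, ?_⟩
  refine Multiset.eq_replicate.2 ⟨rfl, fun x hx => ?_⟩
  have e3 := h.two_mul_card_le (Multiset.erase_le x X)
  have e4 := Multiset.sum_erase hx
  have e5 := Multiset.card_erase_add_one hx
  have e6 := h0 x hx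
  omega

theorem not_mixed_rep (h : ZeroSumConfig n r k X Y) {y j a b : ℕ} {I : Multiset ℕ} (hy : y ∈ Y)
    (hj : j ≤ k) (hI : I ≤ X) (hs : j + I.sum + y = n) (ha : a ∈ I) : b ∉ X - I := by
  intro hb
  obtain ⟨hk, hn, hr, hq, hX⟩ := h.mixed_rep hy hj hI hs ha hb
  set q := Multiset.card X with hqdef
  have hcard := h.card_eq
  -- The remaining candidate is 1^2 2^q 4^(q+1) modulo 2q + 3, which has zero-sum subsequences of a
  -- second length.
  have hY : Y = Multiset.replicate (q + 1) 4 := by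
    refine Multiset.eq_replicate.2 ⟨by omega, fun z hz => ?_⟩
    obtain ⟨i, hi, A, hA, hs'⟩ := h.exists_rep z hz
    have hr' := h.card_rep hz hi hA hs'
    have hA' := hA
    rw [hX, Multiset.le_replicate_iff] at hA'
    obtain ⟨l, hl, rfl⟩ := hA'
    simp only [Multiset.card_replicate, Multiset.sum_replicate, smul_eq_mul] at hr' hs'
    have h1 : l ≠ 0 → k < i + 2 := fun h0 =>
      h.lt_add_of_mem_rep hz hi hA (by simpa using hs') (Multiset.mem_replicate.2 ⟨h0, rfl⟩)
    have h2 : l ≠ q → i < 2 := fun h0 =>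
      h.lt_of_mem_sub_rep hz hi hA (by simpa using hs') (by
        rw [hX, Multiset.mem_sub]
        simp only [Multiset.count_replicate_self]
        omega)
    omega
  have hz : ∀ i ≤ 2, ∀ l ≤ q, ∀ c ≤ q + 1, n ∣ i + l * 2 + c * 4 → 0 < i + l + c →
      i + l + c = r := by
    intro i hi l hl c hc hd h0
    have := h.card_of_dvd i (by omega) (Multiset.replicate l 2)
      (by rw [hX]; exact (Multiset.replicate_le_replicate 2).2 hl) (Multiset.replicate c 4)
      (by rw [hY]; exact (Multiset.replicate_le_replicate 4).2 hc) (by simpa using hd)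
      (by simpa using h0)
    simpa using this
  by_cases hq3 : 3 ≤ q
  · have := hz 1 (by omega) (q - 3) (by omega) 2 (by omega) ⟨1, by omega⟩ (by omega)
    omega
  · have := hz 0 (by omega) 1 (by omega) 3 (by omega) ⟨2, by omega⟩ (by omega)
    omega

theorem rep_eq (h : ZeroSumConfig n r k X Y) (hX : X ≠ 0) {y : ℕ} (hy : y ∈ Y) :
    ∃ j < k, j + X.sum + y = n ∧ j + Multiset.card X + 1 = r ∧ ∀ x ∈ X, k < j + x := by
  obtain ⟨j, hj, I, hI, hs⟩ := h.exists_rep y hy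
  have hI0 : I ≠ 0 := by
    rintro rfl
    exact h.rep_ne_zero hX hy hj (by simpa using hs)
  obtain ⟨a, ha⟩ := Multiset.exists_mem_of_ne_zero hI0
  have hXI : X - I = 0 := by
    rw [Multiset.eq_zero_iff_forall_notMem]
    exact fun b => h.not_mixed_rep hy hj hI hs ha
  obtain rfl : X = I := le_antisymm (by simpa [tsub_eq_zero_iff_le] using hXI) hI
  have hr := h.card_rep hy hj hI hs
  have := h.le_card
  exact ⟨j, by omega, hs, hr, fun x hx => h.lt_add_of_mem_rep hy hj hI hs hx⟩

/-- Every completion uses all of X, so Y is constant. Comparing it with a completion of two copies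
of y that omits a single x gives x = y by length. -/
theorem exists_two_terms (h : ZeroSumConfig n r k X Y) (hX : X ≠ 0) :
    ∃ y j, j < k ∧ j + X.sum + y = n ∧ j + Multiset.card X + 1 = r ∧ k < j + y ∧ 2 ≤ y ∧ y ≤ k ∧
      X = Multiset.replicate (Multiset.card X) y ∧ Y = Multiset.replicate (Multiset.card Y) y := by
  obtain ⟨h0, h3, h4, h5, h6, h7, h8, -, -⟩ := id h
  obtain ⟨y, hy⟩ := Multiset.card_pos_iff_exists_mem.1 (by omega : 0 < Multiset.card Y)
  obtain ⟨j, hj, hs, hr, hlt⟩ := h.rep_eq hX hy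
  have hY : Y = Multiset.replicate (Multiset.card Y) y := by
    refine Multiset.eq_replicate.2 ⟨rfl, fun z hz => ?_⟩
    obtain ⟨i, hi, hs', hr', -⟩ := h.rep_eq hX hz
    omega
  have hyy : ({y, y} : Multiset ℕ) ≤ Y := by
    rw [hY]
    exact (Multiset.replicate_le_replicate y (k := 2)).2 h6
  obtain ⟨t, ht⟩ : ∃ t, k = j + t := ⟨k - j, by omega⟩
  -- The number t counts the unused ones and d is the gap between n and the sum of 1^k X, so y = d +
  -- t.
  obtain ⟨d, hd⟩ : ∃ d, n = k + X.sum + d := ⟨n - (k + X.sum), by omega⟩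
  have hyd : y = d + t := by omega
  have hA : k < d + 2 * t := by
    by_contra! hcon
    have := h.card_pair (j := k - (d + 2 * t)) hyy (by omega) le_rfl ⟨1, by omega⟩
    omega
  have hq : 1 ≤ Multiset.card X := Multiset.card_pos.2 hX
  have hB : d + t ≤ k + 1 := by
    have e1 := Multiset.card_nsmul_le_sum (s := X) (a := t + 1)
      fun x hx => by have := hlt x hx; omega
    rw [smul_eq_mul] at e1
    have e2 : Multiset.card X * (t + 1) + d ≤ Multiset.card X + Multiset.card Y := by omega
    obtain ⟨q, hq'⟩ : ∃ q, Multiset.card X = q + 1 := ⟨Multiset.card X - 1, by omega⟩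
    obtain ⟨t', rfl⟩ : ∃ t', t = t' + 1 := ⟨t - 1, by omega⟩
    rw [hq'] at e2
    nlinarith [Nat.zero_le (q * t')]
  have hxy : ∀ x ∈ X, x = y := by
    intro x hx
    have e1 := hlt x hx
    have e2 := h.le_of_mem hx
    have e3 := Multiset.sum_erase hx
    have e4 := Multiset.card_erase_add_one hx
    have := h.card_pair (j := k + x - (d + 2 * t)) (I := X.erase x) hyy (by omega)
      (Multiset.erase_le _ _) ⟨1, by omega⟩
    omega
  obtain ⟨x, hx⟩ := Multiset.exists_mem_of_ne_zero hX
  obtain rfl := hxy x hx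
  exact ⟨x, j, hj, hs, hr, hlt x hx, h0 x hx, h.le_of_mem hx,
    Multiset.eq_replicate.2 ⟨rfl, hxy⟩, hY⟩

theorem two_terms_of_ne_zero (h : ZeroSumConfig n r k X Y) (hX : X ≠ 0) :
    k = 2 ∧ X + Y = Multiset.replicate (n - 2) 2 ∧ Odd n ∧ r = (n + 1) / 2 := by
  obtain ⟨y, j, hj, hs, hr, hky, hy2, hyk, hXr, hYr⟩ := h.exists_two_terms hX
  obtain ⟨-, h3, h4, h5, h6, h7, h8, -, -⟩ := id h
  have hq : 1 ≤ Multiset.card X := Multiset.card_pos.2 hX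
  set q := Multiset.card X with hqdef
  set m := Multiset.card Y with hmdef
  have hXs : X.sum = q * y := by rw [hXr]; simp
  have hXY : X + Y = Multiset.replicate (q + m) y := by
    rw [hXr, hYr, Multiset.replicate_add]
  have hz : ∀ i ≤ k, ∀ c ≤ q + m, n ∣ i + c * y → 0 < i + c → i + c = r := by
    intro i hi c hc hd h0
    have hc' : min c q + (c - min c q) = c := by omega
    have hd' : min c q * y + (c - min c q) * y = c * y := by rw [← add_mul, hc']
    have := h.card_of_dvd i hi (Multiset.replicate (min c q) y)
      (by rw [hXr]; exact (Multiset.replicate_le_replicate y).2 (by omega))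
      (Multiset.replicate (c - min c q) y)
      (by rw [hYr]; exact (Multiset.replicate_le_replicate y).2 (by omega))
      (by
        simp only [Multiset.sum_replicate, smul_eq_mul]
        rwa [add_assoc, hd'])
      (by simp only [Multiset.card_replicate]; omega)
    simp only [Multiset.card_replicate] at this
    omega
  rw [hXs] at hs h3
  -- Otherwise y of the ones could be traded for another copy of y.
  have hjy : j < y := by
    by_contra! hcon
    have := hz (j - y) (by omega) (q + 2) (by omega) ⟨1, by rw [add_mul]; omega⟩ (by omega)
    omega
  suffices y = 2 ∧ k = 2 ∧ n = 2 * q + 3 by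
    obtain ⟨rfl, rfl, hn⟩ := this
    refine ⟨rfl, ?_, by rw [Nat.odd_iff]; omega, by omega⟩
    rw [hXY]
    congr 1
    omega
  clear_value q m
  obtain rfl | rfl | hq3 : q = 1 ∨ q = 2 ∨ 3 ≤ q := by omega
  · by_cases hy3 : 3 ≤ y
    · exfalso
      by_cases hc : n = 3 * y - 1 ∧ k = 2 * y - 3
      · have := hz (y - 2) (by omega) 5 (by omega) ⟨2, by omega⟩ (by omega)
        omega
      · have := hz (2 * n - 4 * y) (by omega) 4 (by omega) ⟨2, by omega⟩ (by omega)
        omega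
    · omega
  · by_cases hy3 : 3 ≤ y
    · exfalso
      have e1 : y = 3 := by omega
      subst e1
      have := hz 4 (by omega) 6 (by omega) ⟨2, by omega⟩ (by omega)
      omega
    · have e1 : y = 2 := by omega
      subst e1
      omega
  · have e1 : y = 2 := by
      by_contra hne
      have : q * 3 ≤ q * y := Nat.mul_le_mul_left q (by omega)
      obtain ⟨z, rfl⟩ : ∃ z, y = z + 3 := ⟨y - 3, by omega⟩
      rw [mul_add] at *
      have : 3 * z ≤ q * z := Nat.mul_le_mul_right z hq3
      omega
    subst e1
    omega

end ZeroSumConfig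

/-- The possible shapes of `S` over a cyclic group. -/
def CyclicShape {G : Type*} [AddCommGroup G] (n r : ℕ) (S : Multiset G) : Prop :=
  ∃ g : G, AddSubgroup.zmultiples g = ⊤ ∧
    ((∃ g' : G, S = twoTermSeq g (n - 1) g' 1) ∨
     (∃ g'' : G, g'' ∉ AddSubgroup.zmultiples (2 • g) ∧
        S = twoTermSeq (2 • g) (n - 1) g'' 1) ∨
     (Odd n ∧ r = (n + 1) / 2 ∧ S = twoTermSeq g (n - 2) (((n + 1) / 2) • g) 2) ∨
     (n ≡ 2 [MOD 4] ∧ r = n / 2 ∧ ∃ x ∈ Set.Icc 0 (n / 2 - 1), Even x ∧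
        S = twoTermSeq (2 • g) (n / 2 + x) (((n + 4) / 2) • g) (n / 2 - x)) ∨
     (Even n ∧ r = n / 2 ∧ ∃ x ∈ Set.Icc 0 (n / 2 - 1), Odd (n / 2 - x) ∧
        S = twoTermSeq g (n / 2 + x) (((n + 2) / 2) • g) (n / 2 - x)))

/-! ### Reduction of the long case to residues -/

theorem Multiset.exists_le_map_eq {α β : Type*} {f : α → β} {L : Multiset α} {T : Multiset β}
    (h : T ≤ L.map f) : ∃ L' ≤ L, L'.map f = T := by
  induction L using Quotient.inductionOn with
  | _ l =>
  induction T using Quotient.inductionOn with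
  | _ t =>
  obtain ⟨t', ht, hsub⟩ := h
  obtain ⟨l', hl', rfl⟩ := List.sublist_map_iff.1 hsub
  exact ⟨l', hl'.subperm, by simpa using ht⟩

theorem Multiset.sum_map_nsmul_right {G : Type*} [AddCommGroup G] (L : Multiset ℕ) (g : G) :
    (L.map (· • g)).sum = L.sum • g := by
  induction L using Multiset.induction_on with
  | empty => simp
  | cons a L ih => simp [add_nsmul, ih]

theorem Multiset.replicate_count_add_filter {α : Type*} [DecidableEq α] (L : Multiset α) (a : α) :
    Multiset.replicate (L.count a) a + L.filter (· ≠ a) = L := by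
  rw [← Multiset.filter_eq', Multiset.filter_add_not]

section

variable {G : Type*} [AddCommGroup G]

theorem isAddCyclic_of_zmultiples_eq_top {g : G} (h : AddSubgroup.zmultiples g = ⊤) :
    IsAddCyclic G :=
  ⟨g, fun x => (AddSubgroup.mem_zmultiples_iff.1 (h ▸ AddSubgroup.mem_top x :) :)⟩

variable [Finite G]

theorem zmultiples_eq_top_of_addOrderOf {g : G} (h : addOrderOf g = Nat.card G) :
    AddSubgroup.zmultiples g = ⊤ :=
  AddSubgroup.eq_top_of_card_eq _ (by rw [Nat.card_zmultiples, h])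

theorem exists_lt_nsmul_eq {g : G} {n : ℕ} (h : AddSubgroup.zmultiples g = ⊤)
    (hn : addOrderOf g = n) (a : G) : ∃ c < n, c • g = a := by
  have ha : a ∈ AddSubgroup.zmultiples g := by rw [h]; trivial
  classical
  rw [mem_zmultiples_iff_mem_range_addOrderOf] at ha
  simpa [hn] using ha

theorem cyclicShape_of_long_zeroSumFree [DecidableEq G] {n r : ℕ} {S W : Multiset G}
    (hn : Nat.card G = n) (hS : Multiset.card S = n)
    (H : ∀ T ≤ S, T ≠ 0 → T.sum = 0 → Multiset.card T = r) (hWS : W ≤ S) (hW : ZeroSumFree W)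
    (hmax : ∀ V ≤ S, Multiset.card W < Multiset.card V → ¬ ZeroSumFree V)
    (hlong : n + 1 ≤ 2 * Multiset.card W) (hW2 : Multiset.card W + 2 ≤ n)
    (hr1 : n ≤ r + Multiset.card W) (hr2 : r ≤ Multiset.card W) :
    IsAddCyclic G ∧ CyclicShape n r S := by
  obtain ⟨g, L, hWL, hL1, hLs, -⟩ := hW.exists_eq_map_nsmul (by
    have := card_subsums_le W; omega)
  have hcardL : Multiset.card L = Multiset.card W := by rw [hWL, Multiset.card_map]
  have hLc := card_le_sum_of_one_le hL1
  have hord : addOrderOf g = n := by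
    -- The order of g divides n and exceeds ΣL ≥ |W| > n/2, so it equals n.
    obtain ⟨c, hc⟩ : addOrderOf g ∣ n := hn ▸ addOrderOf_dvd_natCard g
    have hc1 : c = 1 := by
      rcases c with _ | _ | c
      · omega
      · rfl
      · have : addOrderOf g * 2 ≤ addOrderOf g * (c + 1 + 1) := Nat.mul_le_mul_left _ (by omega)
        omega
    rw [hc1, mul_one] at hc
    exact hc.symm
  have htop := zmultiples_eq_top_of_addOrderOf (hord.trans hn.symm)
  refine ⟨isAddCyclic_of_zmultiples_eq_top htop, ?_⟩
  choose f hf1 hf2 using exists_lt_nsmul_eq htop hord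
  set Y := (S - W).map f with hYdef
  have hY : Y.map (· • g) = S - W := by
    rw [hYdef, Multiset.map_map]
    simp [hf2]
  have hYcard : Multiset.card Y + Multiset.card W = n := by
    rw [hYdef, Multiset.card_map, ← hS, ← Multiset.card_add, tsub_add_cancel_of_le hWS]
  set k := L.count 1 with hk
  set X := L.filter (· ≠ 1) with hXdef
  have hLX : Multiset.replicate k 1 + X = L := Multiset.replicate_count_add_filter L 1
  have hSL : S = (Multiset.replicate k 1 + X + Y).map (· • g) := by
    rw [hLX, Multiset.map_add, hY, ← hWL, add_tsub_cancel_of_le hWS]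
  have hX2 : ∀ x ∈ X, 2 ≤ x := by
    intro x hx
    have h1 := Multiset.mem_filter.1 hx
    have h2 := hL1 x h1.1
    have h3 : x ≠ 1 := h1.2
    omega
  have hLcard : k + Multiset.card X = Multiset.card L := by
    rw [← hLX, Multiset.card_add, Multiset.card_replicate]
  have hLsum : k + X.sum = L.sum := by
    rw [← hLX, Multiset.sum_add, Multiset.sum_replicate]; simp
  have hconf : ZeroSumConfig n r k X Y := by
    refine ⟨hX2, by omega, by omega, by omega, by omega, by omega, by omega, ?_, ?_⟩
    · intro y hy
      obtain ⟨a, ha, rfl⟩ := Multiset.mem_map.1 hy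
      have haS : a ::ₘ W ≤ S := by
        rw [← tsub_add_cancel_of_le hWS, ← Multiset.singleton_add]
        exact add_le_add_left (by simpa using ha) _
      have hnz := hmax _ haS (by simp)
      unfold ZeroSumFree at hnz
      push Not at hnz
      obtain ⟨A, hA, hA0, hAne⟩ := hnz
      have haA : a ∈ A := by
        by_contra haA
        exact hAne (hW A ((Multiset.le_cons_of_notMem haA).1 hA) hA0)
      have hAW : A.erase a ≤ L.map (· • g) := by
        rw [← hWL]; exact Multiset.erase_le_iff_le_cons.2 hA
      obtain ⟨A', hA', hmap⟩ := Multiset.exists_le_map_eq hAW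
      have hsum : a + A'.sum • g = 0 := by
        rw [← Multiset.sum_map_nsmul_right, hmap, Multiset.sum_erase haA, hA0]
      have hdvd : n ∣ f a + A'.sum := by
        rw [← hord, addOrderOf_dvd_iff_nsmul_eq_zero, add_nsmul, hf2, hsum]
      have ha0 : f a ≠ 0 := by
        intro h0
        have h1 : a = 0 := by rw [← hf2 a, h0, zero_nsmul]
        have h2 := H {a} (by simpa using Multiset.mem_of_le tsub_le_self ha) (by simp)
          (by simpa using h1)
        simp only [Multiset.card_singleton] at h2
        omega
      have hA's : A'.sum ≤ L.sum := by
        obtain ⟨B, rfl⟩ := Multiset.le_iff_exists_add.1 hA'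
        rw [Multiset.sum_add]; omega
      have hfn := hf1 a
      -- Both summands are below n and the sum is a positive multiple of n.
      have heq : f a + A'.sum = n := by
        obtain ⟨c, hc⟩ := hdvd
        rcases c with _ | _ | c
        · omega
        · omega
        · have : n * 2 ≤ n * (c + 1 + 1) := Nat.mul_le_mul_left _ (by omega)
          omega
      refine ⟨A'.count 1, Multiset.count_le_of_le _ hA', A'.filter (· ≠ 1),
        Multiset.filter_le_filter _ hA', ?_⟩
      have h3 := congrArg Multiset.sum (Multiset.replicate_count_add_filter A' 1)
      rw [Multiset.sum_add, Multiset.sum_replicate] at h3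
      simp only [smul_eq_mul, mul_one] at h3
      omega
    · intro i hi X' hX' Y' hY' hd h0
      have hle : (Multiset.replicate i 1 + X' + Y').map (· • g) ≤ S := by
        rw [hSL]
        exact Multiset.map_le_map (add_le_add (add_le_add
          ((Multiset.replicate_le_replicate 1).2 hi) hX') hY')
      have hcard : Multiset.card ((Multiset.replicate i 1 + X' + Y').map (· • g)) =
          i + Multiset.card X' + Multiset.card Y' := by simp
      rw [← hcard]
      refine H _ hle ?_ ?_
      · rw [← Multiset.card_pos, hcard]; exact h0
      · rw [Multiset.sum_map_nsmul_right, ← addOrderOf_dvd_iff_nsmul_eq_zero, hord]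
        simpa using hd
  by_cases hX0 : X = 0
  · rw [hX0] at hconf
    refine ⟨g, htop, ?_⟩
    rw [hX0] at hSL hLcard
    simp only [Multiset.card_zero] at hLcard
    rcases hconf.two_terms_of_eq_zero with ⟨h1, h2, h3, h4⟩ | ⟨h1, h2, h3, h4⟩
    · refine Or.inr (Or.inr (Or.inl ⟨h3, h4, ?_⟩))
      rw [hSL, h1, h2]
      simp [twoTermSeq]
    · refine Or.inr (Or.inr (Or.inr (Or.inr ⟨⟨r, by omega⟩, by omega, k - r, ?_, ?_, ?_⟩)))
      · simp only [Set.mem_Icc]; omega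
      · rwa [show n / 2 - (k - r) = n - k by omega]
      · rw [hSL, h4, show n / 2 - (k - r) = n - k by omega, show n / 2 + (k - r) = k by omega]
        simp [twoTermSeq]
  -- Here S = g^2 (2g)^(n-2) with n odd: 2g is again a generator and g is (n + 1)/2 times it.
  · obtain ⟨h1, h2, h3, h4⟩ := hconf.two_terms_of_ne_zero hX0
    have hg : ((n + 1) / 2) • (2 • g) = g := by
      obtain ⟨p, hp⟩ := h3
      rw [smul_smul, show (n + 1) / 2 * 2 = n + 1 by omega, add_nsmul, ← hord,
        addOrderOf_nsmul_eq_zero]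
      simp
    refine ⟨2 • g, ?_, Or.inr (Or.inr (Or.inl ⟨h3, h4, ?_⟩))⟩
    · rw [eq_top_iff, ← htop]
      have := AddSubgroup.nsmul_mem _ (AddSubgroup.mem_zmultiples (2 • g)) ((n + 1) / 2)
      rw [hg] at this
      exact AddSubgroup.zmultiples_le_of_mem this
    · rw [hg, hSL, add_assoc, h1, h2]
      simp [twoTermSeq, add_comm]

end

/-! ### The balanced case n = 2r: exchange arguments -/

/-- A sequence `S` of length `|G| = 2 * r`, all of whose nonempty zero-sum subsequences have length
`r`, and whose zero-sum free subsequences have length at most `r`. -/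
structure BalancedConfig {G : Type*} [AddCommGroup G] (r : ℕ) (S : Multiset G) : Prop where
  two_le : 2 ≤ r
  card_group : Nat.card G = 2 * r
  card_eq : Multiset.card S = 2 * r
  card_of_sum : ∀ T ≤ S, T ≠ 0 → T.sum = 0 → Multiset.card T = r
  not_free : ∀ V ≤ S, r < Multiset.card V → ¬ ZeroSumFree V

theorem exists_le_sum_mem_of_not_zeroSumFree {G : Type*} [AddCommGroup G] {K : AddSubgroup G}
    {M : Multiset G} (h : ¬ ZeroSumFree (M.map (QuotientAddGroup.mk' K))) :
    ∃ A ≤ M, A ≠ 0 ∧ A.sum ∈ K := by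
  unfold ZeroSumFree at h
  push Not at h
  obtain ⟨T, hT, hT0, hne⟩ := h
  obtain ⟨A, hA, rfl⟩ := Multiset.exists_le_map_eq hT
  refine ⟨A, hA, fun h0 => hne (by simp [h0]), ?_⟩
  rw [← map_multiset_sum] at hT0
  rwa [← QuotientAddGroup.ker_mk' K, AddMonoidHom.mem_ker]

theorem Multiset.exists_le_card_eq {α : Type*} {M : Multiset α} {k : ℕ}
    (h : k ≤ Multiset.card M) : ∃ A ≤ M, Multiset.card A = k := by
  induction M using Quotient.inductionOn with
  | _ l => exact ⟨l.take k, (List.take_sublist k l).subperm, by simpa using h⟩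

theorem Multiset.pair_le_of_ne {α : Type*} [DecidableEq α] {M : Multiset α} {a b : α} (ha : a ∈ M)
    (hb : b ∈ M) (hne : a ≠ b) : ({a, b} : Multiset α) ≤ M := by
  rw [← Multiset.cons_erase ha, Multiset.insert_eq_cons]
  exact Multiset.cons_le_cons _ (by simpa using (Multiset.mem_erase_of_ne hne.symm).2 hb)

theorem Multiset.exists_eq_replicate_add_replicate {α : Type*} [DecidableEq α] {M : Multiset α}
    {a b : α} (hab : a ≠ b) (h : ∀ x ∈ M, x = a ∨ x = b) :
    M = Multiset.replicate (M.count a) a + Multiset.replicate (M.count b) b := by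
  ext x
  rw [Multiset.count_add, Multiset.count_replicate, Multiset.count_replicate]
  by_cases hx : x ∈ M
  · rcases h x hx with rfl | rfl
    · simp [hab.symm]
    · simp [hab]
  · have h0 : M.count x = 0 := Multiset.count_eq_zero.2 hx
    rw [h0]
    split_ifs with h1 h2 h2 <;> simp_all

theorem eq_zero_or_eq_of_mem_zmultiples {G : Type*} [AddCommGroup G] {s h : G} (h2 : 2 • s = 0) (hh : h ∈ AddSubgroup.zmultiples s) :
    h = 0 ∨ h = s := by
  obtain ⟨c, rfl⟩ := AddSubgroup.mem_zmultiples_iff.1 hh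
  rcases Int.even_or_odd' c with ⟨d, rfl | rfl⟩
  · left
    rw [mul_comm, mul_smul]
    simpa [two_zsmul, two_nsmul] using congrArg (d • ·) h2
  · right
    rw [add_smul, mul_comm, mul_smul, one_smul]
    have : (2 : ℤ) • s = 0 := by simpa [two_zsmul, two_nsmul] using h2
    rw [this]; simp

namespace BalancedConfig

variable {G : Type*} [AddCommGroup G] {r : ℕ} {S : Multiset G}

theorem sum_ne_zero (h : BalancedConfig r S) : S.sum ≠ 0 := by
  intro h0
  have h2 := h.two_le
  have h3 := h.card_eq
  have := h.card_of_sum S le_rfl (by rw [← Multiset.card_pos]; omega) h0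
  omega

/-- Among the r + 1 terms of V and z there is a zero-sum subsequence of length r. The one omitted
term equals z + σ(V), and it is not z because σ(V) ≠ 0. -/
theorem exchange (h : BalancedConfig r S) {V U : Multiset G} (hVU : V + U = S)
    (hV : Multiset.card V = r) (hs : V.sum ≠ 0) {z : G} (hz : z ∈ U) : z + V.sum ∈ V := by
  have hle : z ::ₘ V ≤ S := by
    rw [← hVU, add_comm, ← Multiset.singleton_add]
    exact add_le_add_left (by simpa using hz) _
  have hnf := h.not_free _ hle (by rw [Multiset.card_cons, hV]; omega)
  unfold ZeroSumFree at hnf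
  push Not at hnf
  obtain ⟨A, hA, hA0, hne⟩ := hnf
  have hc := h.card_of_sum A (hA.trans hle) hne hA0
  obtain ⟨B, hB⟩ := Multiset.le_iff_exists_add.1 hA
  have hBc : Multiset.card B = 1 := by
    have := congrArg Multiset.card hB
    rw [Multiset.card_add, Multiset.card_cons] at this
    omega
  obtain ⟨a, rfl⟩ := Multiset.card_eq_one.1 hBc
  have hsum := congrArg Multiset.sum hB
  rw [Multiset.sum_add, Multiset.sum_cons, hA0, Multiset.sum_singleton, zero_add] at hsum
  have ha : a ∈ z ::ₘ V := by rw [hB]; simp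
  rcases Multiset.mem_cons.1 ha with rfl | ha
  · exact absurd (by simpa using hsum) hs
  · rwa [hsum]

theorem add_sum_mem (h : BalancedConfig r S) {T U : Multiset G} (hTU : T + U = S)
    (hT : T.sum = 0) (hT0 : T ≠ 0) {z : G} (hz : z ∈ T) : z + S.sum ∈ U := by
  have hU : U.sum = S.sum := by rw [← hTU, Multiset.sum_add, hT, zero_add]
  have hc := h.card_of_sum T (hTU ▸ Multiset.le_add_right T U) hT0 hT
  have hc2 := congrArg Multiset.card hTU
  rw [Multiset.card_add, h.card_eq] at hc2
  rw [← hU]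
  exact h.exchange (by rw [add_comm, hTU]) (by omega) (hU ▸ h.sum_ne_zero) hz

variable [DecidableEq G] [Finite G]

/-- Swapping x, y with x + s, y + s gives halves V and V' of sums 2s and -s. Exchanging both ways
makes V stable under translation by s, and V' contains V + ⟨s⟩. A short subsequence of V with sum in
⟨s⟩ can then be corrected in one term to a zero-sum subsequence shorter than r. -/
theorem false_of_pair (h : BalancedConfig r S) {T U : Multiset G} {x y : G}
    (hS : T + {x, y} + (U + {x + S.sum, y + S.sum}) = S) (hT : (T + {x, y}).sum = 0)
    (h2 : 2 • S.sum ≠ 0) : False := by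
  set s := S.sum with hs
  have hc := h.card_of_sum (T + {x, y}) (Multiset.le_iff_exists_add.2 ⟨_, hS.symm⟩)
    (by rw [← Multiset.card_pos]; simp) hT
  set V := T + {x + s, y + s} with hVdef
  set V' := U + {x, y} with hV'def
  have hVV : V + V' = S := by
    rw [← hS, hVdef, hV'def]
    abel
  have hVV' : V' + V = S := by rw [add_comm, hVV]
  have hVc : Multiset.card V = r := by
    rw [← hc, hVdef]; simp
  have hV'c : Multiset.card V' = r := by
    have := congrArg Multiset.card hVV
    rw [Multiset.card_add, h.card_eq] at this
    omega
  have hVs : V.sum = 2 • s := by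
    simp only [Multiset.sum_add, Multiset.insert_eq_cons, Multiset.sum_cons,
      Multiset.sum_singleton] at hT
    have : V.sum = (T.sum + (x + y)) + 2 • s := by
      simp only [hVdef, Multiset.sum_add, Multiset.insert_eq_cons, Multiset.sum_cons,
        Multiset.sum_singleton]
      abel
    rw [this, hT, zero_add]
  have hV's : V'.sum = -s := by
    have := congrArg Multiset.sum hVV
    rw [Multiset.sum_add, hVs, ← hs] at this
    rw [eq_sub_of_add_eq' this]
    abel
  have e1 : ∀ z ∈ V', z + 2 • s ∈ V := fun z hz => by
    rw [← hVs]
    exact h.exchange hVV hVc (hVs ▸ h2) hz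
  have e2 : ∀ z ∈ V, z + -s ∈ V' := fun z hz => by
    rw [← hV's]
    exact h.exchange hVV' hV'c (by rw [hV's, neg_ne_zero]; exact h.sum_ne_zero) hz
  have e3 : ∀ z ∈ V, z + s ∈ V := fun z hz => by
    have := e1 _ (e2 z hz)
    rwa [show z + -s + 2 • s = z + s by abel] at this
  have e4 : ∀ (j : ℕ), ∀ z ∈ V, z + j • s ∈ V := by
    intro j
    induction j with
    | zero => simp
    | succ j ih =>
      intro z hz
      have := e3 _ (ih z hz)
      rwa [add_assoc, ← succ_nsmul] at this
  set K := AddSubgroup.zmultiples s with hK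
  have e5 : ∀ a ∈ V, ∀ b ∈ K, a + b ∈ V' := by
    intro a ha b hb
    obtain ⟨j, rfl⟩ := mem_multiples_iff_mem_zmultiples.2 hb
    have := e2 _ (e4 (j + 1) a ha)
    rwa [succ_nsmul, show a + (j • s + s) + -s = a + j • s by abel] at this
  -- Since s ≠ 0 and 2s ≠ 0, the subgroup ⟨s⟩ has at least three elements.
  have hcardQ : Nat.card (G ⧸ K) < r := by
    have h3 := AddSubgroup.card_eq_card_quotient_mul_card_addSubgroup K
    have h4 : 3 ≤ Nat.card K := by
      rw [hK, Nat.card_zmultiples]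
      have p1 : addOrderOf s ≠ 0 := (addOrderOf_pos s).ne'
      have p2 : addOrderOf s ≠ 1 := by
        rw [Ne, AddMonoid.addOrderOf_eq_one_iff]; exact h.sum_ne_zero
      have p3 : addOrderOf s ≠ 2 := fun p => h2 (by rw [← p]; exact addOrderOf_nsmul_eq_zero s)
      omega
    rw [h.card_group] at h3
    have h5 := h.two_le
    by_contra! hcon
    nlinarith
  obtain ⟨V₀, hV₀, hV₀c⟩ : ∃ V₀ ≤ V, Multiset.card V₀ = Nat.card (G ⧸ K) :=
    Multiset.exists_le_card_eq (by omega)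
  classical
  have hnf : ¬ ZeroSumFree (V₀.map (QuotientAddGroup.mk' K)) := fun hf => by
    have := hf.card_lt
    rw [Multiset.card_map] at this
    omega
  obtain ⟨A, hA, hA0, hAK⟩ := exists_le_sum_mem_of_not_zeroSumFree hnf
  obtain ⟨a, ha⟩ := Multiset.exists_mem_of_ne_zero hA0
  have hb := e5 a (Multiset.mem_of_le (hA.trans hV₀) ha) (-A.sum) (K.neg_mem hAK)
  have hle : A.erase a + {a + -A.sum} ≤ S := by
    rw [← hVV]
    exact add_le_add (((Multiset.erase_le a A).trans hA).trans hV₀) (by simpa using hb)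
  have hcard := h.card_of_sum _ hle (by rw [← Multiset.card_pos]; simp) (by
    have := Multiset.sum_erase ha
    rw [Multiset.sum_add, Multiset.sum_singleton, ← add_assoc, add_comm _ a, this]
    simp)
  rw [Multiset.card_add, Multiset.card_singleton, Multiset.card_erase_add_one ha] at hcard
  have := Multiset.card_le_card hA
  omega

theorem eq_of_mem (h : BalancedConfig r S) (h2 : 2 • S.sum ≠ 0) {T : Multiset G}
    (hT : T ≤ S) (hT0 : T.sum = 0) {x y : G} (hx : x ∈ T) (hy : y ∈ T) : x = y := by
  by_contra hne
  obtain ⟨U, hU⟩ := Multiset.le_iff_exists_add.1 hT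
  have hTne : T ≠ 0 := by rintro rfl; simp at hx
  have hu := h.add_sum_mem hU.symm hT0 hTne hx
  have hv := h.add_sum_mem hU.symm hT0 hTne hy
  have h3 := Multiset.pair_le_of_ne hx hy hne
  have h4 := Multiset.pair_le_of_ne hu hv (by simpa using hne)
  refine h.false_of_pair (T := T - {x, y}) (U := U - {x + S.sum, y + S.sum}) (x := x) (y := y)
    ?_ ?_ h2
  · rw [tsub_add_cancel_of_le h3, tsub_add_cancel_of_le h4, ← hU]
  · rw [tsub_add_cancel_of_le h3, hT0]

theorem eq_replicate_add_singleton (h : BalancedConfig r S) (h2 : 2 • S.sum ≠ 0)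
    {T : Multiset G} (hT : T ≤ S) (hT0 : T.sum = 0) (hne : T ≠ 0) :
    ∃ x u : G, S = Multiset.replicate (2 * r - 1) x + {u} ∧ r • x = 0 := by
  have hr := h.two_le
  have hc := h.card_of_sum T hT hne hT0
  obtain ⟨x, hx⟩ := Multiset.exists_mem_of_ne_zero hne
  have hTx : T = Multiset.replicate r x :=
    Multiset.eq_replicate.2 ⟨hc, fun y hy => h.eq_of_mem h2 hT hT0 hy hx⟩
  obtain ⟨U, hU⟩ := Multiset.le_iff_exists_add.1 hT
  have hu := h.add_sum_mem hU.symm hT0 hne hx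
  set s := S.sum with hs
  have hUs : U.sum = s := by rw [hs, hU, Multiset.sum_add, hT0, zero_add]
  obtain ⟨U', hU'⟩ := Multiset.exists_cons_of_mem hu
  have hU's : U'.sum + x = 0 := by
    rw [hU', Multiset.sum_cons] at hUs
    have : s + (U'.sum + x) = s + 0 := by rw [add_zero]; nth_rw 2 [← hUs]; abel
    exact add_left_cancel this
  -- Exchanging x + s for x in the complement U yields a second zero-sum sequence, to which
  -- `eq_of_mem` applies as well.
  have hT'le : x ::ₘ U' ≤ S := by
    rw [hU, hU', ← Multiset.singleton_add]
    exact add_le_add (by simpa using hx) (Multiset.le_cons_self _ _)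
  have hT'0 : (x ::ₘ U').sum = 0 := by rw [Multiset.sum_cons, add_comm, hU's]
  have hU'c : Multiset.card U' = r - 1 := by
    have := h.card_of_sum _ hT'le (by simp) hT'0
    rw [Multiset.card_cons] at this
    omega
  have hU'x : U' = Multiset.replicate (r - 1) x :=
    Multiset.eq_replicate.2 ⟨hU'c, fun y hy =>
      h.eq_of_mem h2 hT'le hT'0 (Multiset.mem_cons_of_mem hy) (Multiset.mem_cons_self _ _)⟩
  refine ⟨x, x + s, ?_, by rw [hTx] at hT0; simpa using hT0⟩
  rw [hU, hU', hTx, hU'x, show 2 * r - 1 = r + (r - 1) by omega, Multiset.replicate_add,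
    ← Multiset.singleton_add]
  abel

theorem eq_or_eq_add_of_mem (h : BalancedConfig r S) (h2 : 2 • S.sum = 0)
    {T : Multiset G} (hT : T ≤ S) (hT0 : T.sum = 0) {x y : G} (hx : x ∈ T) (hy : y ∈ T) :
    y = x ∨ y = x + S.sum := by
  by_cases hxy : x = y
  · exact Or.inl hxy.symm
  obtain ⟨U, hU⟩ := Multiset.le_iff_exists_add.1 hT
  have hTne : T ≠ 0 := by rintro rfl; simp at hx
  have hc := h.card_of_sum T hT hTne hT0
  have hadd : ∀ z ∈ T, z + S.sum ∈ U := fun z hz => h.add_sum_mem hU.symm hT0 hTne hz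
  have hUs : U.sum = S.sum := by rw [hU, Multiset.sum_add, hT0, zero_add]
  have hpair := Multiset.pair_le_of_ne hx hy hxy
  have hr := h.two_le
  have hUc : Multiset.card U = r := by
    have := congrArg Multiset.card hU
    rw [Multiset.card_add, h.card_eq] at this
    omega
  by_cases hr2 : r = 2
  · exfalso
    have hTe : {x, y} = T := Multiset.eq_of_le_of_card_le hpair (by simp; omega)
    have hUe : {x + S.sum, y + S.sum} = U := Multiset.eq_of_le_of_card_le
      (Multiset.pair_le_of_ne (hadd x hx) (hadd y hy) (by simpa using hxy)) (by simp; omega)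
    apply h.sum_ne_zero
    rw [← hUs, ← hUe]
    rw [← hTe] at hT0
    simp only [Multiset.insert_eq_cons, Multiset.sum_cons, Multiset.sum_singleton] at hT0 ⊢
    rw [show x + S.sum + (y + S.sum) = (x + y) + 2 • S.sum by abel, hT0, h2, add_zero]
  obtain ⟨T', hT'⟩ := Multiset.le_iff_exists_add.1 hpair
  have hT'c : 0 < Multiset.card T' := by
    have := congrArg Multiset.card hT'
    simp only [Multiset.card_add, Multiset.insert_eq_cons, Multiset.card_cons,
      Multiset.card_singleton] at this
    omega
  obtain ⟨x₀, hx₀⟩ := Multiset.card_pos_iff_exists_mem.1 hT'c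
  have hx₀T : x₀ ∈ T := by rw [hT']; exact Multiset.mem_add.2 (Or.inr hx₀)
  set B := T.erase x₀ with hB
  have hBc : Multiset.card B = r - 1 := by
    rw [hB, Multiset.card_erase_of_mem hx₀T, hc]; rfl
  have hBpair : ({x, y} : Multiset G) ≤ B := by
    rw [hB, hT', Multiset.erase_add_right_pos _ hx₀]
    exact Multiset.le_add_right _ _
  set K := AddSubgroup.zmultiples S.sum with hK
  have hKc : Nat.card K = 2 := by
    rw [hK, Nat.card_zmultiples]
    exact addOrderOf_eq_prime h2 h.sum_ne_zero
  have hQ : Nat.card (G ⧸ K) = r := by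
    have h3 := AddSubgroup.card_eq_card_quotient_mul_card_addSubgroup K
    rw [h.card_group, hKc] at h3
    omega
  have hBT : B ≤ T := Multiset.erase_le _ _
  -- A part A of B with sum 0 is too short. If its sum is s, replacing a by a + s from U makes it
  -- zero-sum, still too short. As |B| = |G/⟨s⟩| - 1, the image of B is then constant.
  have hfree : ZeroSumFree (B.map (QuotientAddGroup.mk' K)) := by
    by_contra hnf
    obtain ⟨A, hA, hA0, hAK⟩ := exists_le_sum_mem_of_not_zeroSumFree hnf
    have hAc := Multiset.card_le_card hA
    rcases eq_zero_or_eq_of_mem_zmultiples h2 hAK with h0 | h1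
    · have := h.card_of_sum A ((hA.trans hBT).trans hT) hA0 h0
      omega
    · obtain ⟨a, ha⟩ := Multiset.exists_mem_of_ne_zero hA0
      have hle : A.erase a + {a + S.sum} ≤ S := by
        nth_rw 2 [hU]
        exact add_le_add (((Multiset.erase_le a A).trans hA).trans hBT)
          (by simpa using hadd a (Multiset.mem_of_le (hA.trans hBT) ha))
      have hcard := h.card_of_sum _ hle (by rw [← Multiset.card_pos]; simp) (by
        have := Multiset.sum_erase ha
        rw [Multiset.sum_add, Multiset.sum_singleton, ← add_assoc, add_comm _ a, this, h1,
          ← two_nsmul, h2])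
      rw [Multiset.card_add, Multiset.card_singleton, Multiset.card_erase_add_one ha] at hcard
      omega
  classical
  obtain ⟨q, hq, -⟩ := hfree.eq_replicate_of_card (by rw [Multiset.card_map, hBc, hQ]; omega)
    (by rw [Multiset.card_map, hBc]; omega)
  have hmk : ∀ z ∈ B, QuotientAddGroup.mk' K z = q := fun z hz => by
    have : QuotientAddGroup.mk' K z ∈ B.map (QuotientAddGroup.mk' K) :=
      Multiset.mem_map_of_mem _ hz
    rw [hq] at this
    exact Multiset.eq_of_mem_replicate this
  have hsub : y - x ∈ K := by
    rw [← QuotientAddGroup.ker_mk' K, AddMonoidHom.mem_ker, map_sub,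
      hmk y (Multiset.mem_of_le hBpair (by simp)), hmk x (Multiset.mem_of_le hBpair (by simp)),
      sub_self]
  rcases eq_zero_or_eq_of_mem_zmultiples h2 hsub with h0 | h1
  · exact absurd (sub_eq_zero.1 h0).symm hxy
  · right
    rw [← h1]; abel

theorem eq_replicate_add_replicate (h : BalancedConfig r S) (h2 : 2 • S.sum = 0)
    {T : Multiset G} (hT : T ≤ S) (hT0 : T.sum = 0) (hne : T ≠ 0) :
    ∃ (x : G) (i j : ℕ), 1 ≤ i ∧ 1 ≤ j ∧
      S = Multiset.replicate i x + Multiset.replicate j (x + S.sum) ∧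
      (r • x = 0 ∨ r • x = S.sum) := by
  have hs := h.sum_ne_zero
  obtain ⟨x, hx⟩ := Multiset.exists_mem_of_ne_zero hne
  obtain ⟨U, hU⟩ := Multiset.le_iff_exists_add.1 hT
  have hu := h.add_sum_mem hU.symm hT0 hne hx
  have hUs : U.sum = S.sum := by rw [hU, Multiset.sum_add, hT0, zero_add]
  have hT'le : U.erase (x + S.sum) + {x} ≤ S := by
    nth_rw 2 [hU]
    rw [add_comm T U]
    exact add_le_add (Multiset.erase_le _ _) (by simpa using hx)
  have hT'0 : (U.erase (x + S.sum) + {x}).sum = 0 := by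
    have := Multiset.sum_erase hu
    rw [hUs] at this
    rw [Multiset.sum_add, Multiset.sum_singleton]
    have h3 : S.sum + ((U.erase (x + S.sum)).sum + x) = S.sum + 0 := by
      rw [add_zero]; nth_rw 3 [← this]; abel
    exact add_left_cancel h3
  have hmem : ∀ z ∈ S, z = x ∨ z = x + S.sum := by
    intro z hz
    rw [hU] at hz
    rcases Multiset.mem_add.1 hz with hz | hz
    · exact h.eq_or_eq_add_of_mem h2 hT hT0 hx hz
    · by_cases hzu : z = x + S.sum
      · exact Or.inr hzu
      · exact h.eq_or_eq_add_of_mem h2 hT'le hT'0 (by simp)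
          (Multiset.mem_add.2 (Or.inl ((Multiset.mem_erase_of_ne hzu).2 hz)))
  have hxx : x ≠ x + S.sum := by simpa using hs
  refine ⟨x, S.count x, S.count (x + S.sum), ?_, ?_,
    Multiset.exists_eq_replicate_add_replicate hxx hmem, ?_⟩
  · exact Multiset.one_le_count_iff_mem.2 (Multiset.mem_of_le hT hx)
  · exact Multiset.one_le_count_iff_mem.2
      (Multiset.mem_of_le (Multiset.le_iff_exists_add.2 ⟨T, by rw [add_comm, ← hU]⟩) hu)
  · have hc := h.card_of_sum T hT hne hT0
    have hTe := Multiset.exists_eq_replicate_add_replicate hxx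
      fun z hz => hmem z (Multiset.mem_of_le hT hz)
    set a := T.count x
    set b := T.count (x + S.sum)
    have hc' := congrArg Multiset.card hTe
    have hs' := congrArg Multiset.sum hTe
    simp only [Multiset.card_add, Multiset.card_replicate, Multiset.sum_add,
      Multiset.sum_replicate, hc, hT0] at hc' hs'
    have hrx : r • x = -(b • S.sum) := by
      rw [eq_neg_iff_add_eq_zero, hs', hc', add_nsmul, nsmul_add]; abel
    have hmemK : r • x ∈ AddSubgroup.zmultiples S.sum := by
      rw [hrx]
      exact neg_mem (AddSubgroup.nsmul_mem_zmultiples _ _)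
    exact eq_zero_or_eq_of_mem_zmultiples h2 hmemK

end BalancedConfig

/-- The possible shapes of `S` over a noncyclic group. -/
def NoncyclicShape {G : Type*} [AddCommGroup G] (n r : ℕ) (S : Multiset G) : Prop :=
  ∃ (m : ℕ) (g h : G),
    n = 4 * m ∧ r = n / 2 ∧ r = 2 * m ∧
    addOrderOf g = n / 2 ∧ addOrderOf h = 2 ∧ h ∉ AddSubgroup.zmultiples g ∧
    IsCompl (AddSubgroup.zmultiples h) (AddSubgroup.zmultiples g) ∧
    Nonempty (G ≃+ ZMod 2 × ZMod (2 * m)) ∧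
    ((∃ g' : G, g' ∉ AddSubgroup.zmultiples g ∧ S = twoTermSeq g (n - 1) g' 1) ∨
     (∃ x ∈ Set.Icc 1 (n / 2 - 1), Odd x ∧
        S = twoTermSeq g (n / 2 + x) (h + g) (n / 2 - x)) ∨
     (∃ x ∈ Set.Icc 1 (n / 2 - 1), Odd x ∧
        S = twoTermSeq g (n / 2 + x) (h + ((n + 4) / 4) • g) (n / 2 - x)))

/-! ### Groups with a cyclic subgroup of index two -/

section

variable {G : Type*} [AddCommGroup G] [Finite G]

theorem index_zmultiples_eq_two {g : G} {r : ℕ} (hcard : Nat.card G = 2 * r)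
    (hg : addOrderOf g = r) : (AddSubgroup.zmultiples g).index = 2 := by
  have h1 := AddSubgroup.index_mul_card (AddSubgroup.zmultiples g)
  have h2 : 0 < addOrderOf g := addOrderOf_pos g
  rw [Nat.card_zmultiples, hg, hcard] at h1
  exact Nat.eq_of_mul_eq_mul_right (hg ▸ h2) h1

theorem mem_or_add_mem_zmultiples {g h : G} {r : ℕ} (hcard : Nat.card G = 2 * r)
    (hg : addOrderOf g = r) (hh : h ∉ AddSubgroup.zmultiples g) (y : G) :
    y ∈ AddSubgroup.zmultiples g ∨ y + h ∈ AddSubgroup.zmultiples g := by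
  rw [AddSubgroup.add_mem_iff_of_index_two (index_zmultiples_eq_two hcard hg)]
  tauto

theorem noncyclic_of_addOrderOf {g h : G} {m : ℕ} (hcard : Nat.card G = 4 * m)
    (hg : addOrderOf g = 2 * m) (hh2 : 2 • h = 0) (hh : h ∉ AddSubgroup.zmultiples g) :
    addOrderOf h = 2 ∧ IsCompl (AddSubgroup.zmultiples h) (AddSubgroup.zmultiples g) ∧
      Nonempty (G ≃+ ZMod 2 × ZMod (2 * m)) ∧ ¬ IsAddCyclic G := by
  have hm : 0 < m := by
    have := Nat.card_pos (α := G); omega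
  have hor := mem_or_add_mem_zmultiples (r := 2 * m) (by omega) hg hh
  have hh0 : h ≠ 0 := by rintro rfl; exact hh (zero_mem _)
  have hgm : (2 * m) • g = 0 := by rw [← hg]; exact addOrderOf_nsmul_eq_zero g
  refine ⟨addOrderOf_eq_prime hh2 hh0, ⟨?_, ?_⟩, ?_, ?_⟩
  · rw [AddSubgroup.disjoint_def]
    intro y hy hy'
    rcases eq_zero_or_eq_of_mem_zmultiples hh2 hy with rfl | rfl
    · rfl
    · exact absurd hy' hh
  · rw [codisjoint_iff, eq_top_iff]
    intro y _
    rcases hor y with hy | hy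
    · exact AddSubgroup.mem_sup_right hy
    · have := sub_mem (AddSubgroup.mem_sup_right hy :
        y + h ∈ AddSubgroup.zmultiples h ⊔ AddSubgroup.zmultiples g)
        (AddSubgroup.mem_sup_left (AddSubgroup.mem_zmultiples h))
      simpa using this
  · have : NeZero (2 * m) := ⟨by omega⟩
    let f₁ : ZMod 2 →+ G := ZMod.lift 2 ⟨zmultiplesHom G h, by
      rw [zmultiplesHom_apply, natCast_zsmul, hh2]⟩
    let f₂ : ZMod (2 * m) →+ G := ZMod.lift (2 * m) ⟨zmultiplesHom G g, by
      rw [zmultiplesHom_apply, natCast_zsmul, hgm]⟩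
    have hf₁ : ∀ c : ℤ, f₁ c = c • h := fun c => by simp [f₁]
    have hf₂ : ∀ c : ℤ, f₂ c = c • g := fun c => by simp only [f₂, ZMod.lift_coe]; simp
    have hsurj : Function.Surjective (f₁.coprod f₂) := by
      intro y
      rcases hor y with hy | hy <;> obtain ⟨c, hc⟩ := AddSubgroup.mem_zmultiples_iff.1 hy
      · refine ⟨(0, (c : ZMod (2 * m))), ?_⟩
        rw [AddMonoidHom.coprod_apply, map_zero, zero_add, hf₂, hc]
      · refine ⟨(((1 : ℤ) : ZMod 2), (c : ZMod (2 * m))), ?_⟩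
        rw [AddMonoidHom.coprod_apply, hf₁, hf₂, hc, one_zsmul,
          show h + (y + h) = y + 2 • h by abel, hh2, add_zero]
    have hbij := hsurj.bijective_of_nat_card_le (by
      rw [Nat.card_prod, Nat.card_zmod, Nat.card_zmod, hcard]; omega)
    exact ⟨(AddEquiv.ofBijective _ hbij).symm⟩
  · rintro ⟨γ, hγ⟩
    have h1 : addOrderOf γ = 4 * m := by
      rw [← hcard]
      exact addOrderOf_eq_card_of_forall_mem_zmultiples fun y => hγ y
    have h2 : (2 * m) • γ = 0 := by
      rcases hor γ with hy | hy <;> obtain ⟨c, hc⟩ := AddSubgroup.mem_zmultiples_iff.1 hy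
      · rw [← hc, smul_comm, hgm, smul_zero]
      · rw [eq_sub_of_add_eq hc.symm, smul_sub, smul_comm, hgm, smul_zero, mul_comm, mul_smul, hh2,
          smul_zero, sub_zero]
    have h3 := addOrderOf_dvd_of_nsmul_eq_zero h2
    rw [h1] at h3
    have := Nat.le_of_dvd (by omega) h3
    omega

/-- Write 2u = c·x. Subtracting a multiple of x from u gives a half of x if c is odd and an element
killed by 2 if c is even. In the latter case with r odd, adding a half of x taken inside ⟨x⟩ gives a
half outside it. -/
theorem exists_half_or_exists_two_torsion {x u : G} {r : ℕ} (hcard : Nat.card G = 2 * r)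
    (hx : addOrderOf x = r) (hu : u ∉ AddSubgroup.zmultiples x) :
    (∃ g : G, 2 • g = x ∧ g ∉ AddSubgroup.zmultiples x) ∨
      (Even r ∧ ∃ h : G, 2 • h = 0 ∧ h ∉ AddSubgroup.zmultiples x) := by
  have h2u : 2 • u ∈ AddSubgroup.zmultiples x := by
    rw [two_nsmul, AddSubgroup.add_mem_iff_of_index_two (index_zmultiples_eq_two hcard hx)]
  obtain ⟨c, hc⟩ := AddSubgroup.mem_zmultiples_iff.1 h2u
  have hnot : ∀ e : ℤ, u - e • x ∉ AddSubgroup.zmultiples x := fun e he => hu (by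
    simpa using add_mem he (AddSubgroup.zsmul_mem_zmultiples x e))
  rcases Int.even_or_odd' c with ⟨e, rfl | rfl⟩
  · have hh : 2 • (u - e • x) = 0 := by
      rw [smul_sub, ← hc, mul_smul, two_zsmul, two_nsmul, sub_self]
    rcases Nat.even_or_odd' r with ⟨p, hp | hp⟩
    · exact Or.inr ⟨⟨p, by omega⟩, _, hh, hnot e⟩
    · left
      refine ⟨(p + 1) • x + (u - e • x), ?_, fun hmem => hnot e ?_⟩
      · rw [smul_add, hh, add_zero, smul_smul, show 2 * (p + 1) = r + 1 by omega, add_nsmul, ← hx,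
          addOrderOf_nsmul_eq_zero, zero_add, one_nsmul]
      · simpa using sub_mem hmem (AddSubgroup.nsmul_mem_zmultiples x (p + 1))
  · left
    refine ⟨u - e • x, ?_, hnot e⟩
    rw [smul_sub, ← hc, add_smul, mul_smul, two_zsmul, two_nsmul, one_smul]
    abel

end

/-! ### The balanced case: identifying the shapes -/

namespace BalancedConfig

variable {G : Type*} [AddCommGroup G] {r : ℕ} {S : Multiset G}

/-- A subsequence of length k < r with t copies of x + s has sum kx + ts, which cannot vanish. Two
consecutive values of t are available, so both parities occur. -/
theorem nsmul_ne_of_lt (h : BalancedConfig r S) (h2 : 2 • S.sum = 0) {x : G} {i j : ℕ}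
    (hi : 1 ≤ i) (hj : 1 ≤ j)
    (hS : S = Multiset.replicate i x + Multiset.replicate j (x + S.sum)) {k : ℕ} (hk : 0 < k)
    (hkr : k < r) : k • x ≠ 0 ∧ k • x ≠ S.sum := by
  have hij : i + j = 2 * r := by
    have := congrArg Multiset.card hS
    rw [h.card_eq] at this
    simpa using this.symm
  have key : ∀ t ≤ k, t ≤ j → k - t ≤ i → k • x + t • S.sum ≠ 0 := by
    intro t htk htj hti h0
    have hle : Multiset.replicate (k - t) x + Multiset.replicate t (x + S.sum) ≤ S := by
      refine le_of_le_of_eq ?_ hS.symm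
      exact add_le_add ((Multiset.replicate_le_replicate _).2 hti)
        ((Multiset.replicate_le_replicate _).2 htj)
    have := h.card_of_sum _ hle (by rw [← Multiset.card_pos]; simp; omega) (by
      rw [Multiset.sum_add, Multiset.sum_replicate, Multiset.sum_replicate, smul_add, ← add_assoc,
        ← add_nsmul, Nat.sub_add_cancel htk, h0])
    simp only [Multiset.card_add, Multiset.card_replicate] at this
    omega
  have heven : ∀ p : ℕ, (p + p) • S.sum = 0 := fun p => by
    rw [← two_mul, mul_comm, mul_smul, h2, smul_zero]
  have k1 := key (k - i) (by omega) (by omega) (by omega)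
  have k2 := key (k - i + 1) (by omega) (by omega) (by omega)
  rw [succ_nsmul] at k2
  rcases Nat.even_or_odd (k - i) with ⟨p, hp⟩ | ⟨p, hp⟩
  · rw [hp, heven] at k1 k2
    refine ⟨by simpa using k1, fun h0 => k2 ?_⟩
    rw [h0, zero_add, ← two_nsmul, h2]
  · rw [hp, two_mul, succ_nsmul, heven, zero_add] at k1 k2
    refine ⟨fun h0 => k2 ?_, fun h0 => k1 ?_⟩
    · rw [h0, zero_add, ← two_nsmul, h2]
    · rw [h0, ← two_nsmul, h2]

/-- As |G|·x = 0, the sum s of S equals j·s, while 2s = 0 and s ≠ 0. -/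
theorem odd_count (h : BalancedConfig r S) (h2 : 2 • S.sum = 0) {x : G} {i j : ℕ}
    (hS : S = Multiset.replicate i x + Multiset.replicate j (x + S.sum)) : Odd j := by
  have hij : i + j = Nat.card G := by
    have := congrArg Multiset.card hS
    rw [h.card_eq, ← h.card_group] at this
    simpa using this.symm
  have hs : S.sum = j • S.sum := by
    nth_rw 1 [hS]
    rw [Multiset.sum_add, Multiset.sum_replicate, Multiset.sum_replicate, smul_add, ← add_assoc,
      ← add_nsmul, hij, card_nsmul_eq_zero', zero_add]
  by_contra hodd
  rw [Nat.not_odd_iff_even] at hodd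
  obtain ⟨p, rfl⟩ := hodd
  apply h.sum_ne_zero
  rw [hs, ← two_mul, mul_comm, mul_smul, h2, smul_zero]

theorem swap_terms (h2 : 2 • S.sum = 0) {x : G} {i j : ℕ}
    (hS : S = Multiset.replicate i x + Multiset.replicate j (x + S.sum)) :
    S = Multiset.replicate j (x + S.sum) + Multiset.replicate i (x + S.sum + S.sum) := by
  rw [add_assoc x, ← two_nsmul, h2, add_zero, add_comm]
  exact hS

variable [Finite G]

/-- Here x generates G and x + s = (r + 1)x. The more frequent term is x, or x + s, which generates
for r even and has to be halved for r odd. -/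
theorem cyclicShape_of_nsmul_eq_sum (h : BalancedConfig r S) (h2 : 2 • S.sum = 0) {x : G}
    {i j : ℕ} (hi : 1 ≤ i) (hj : 1 ≤ j)
    (hS : S = Multiset.replicate i x + Multiset.replicate j (x + S.sum)) (hx : r • x = S.sum) :
    IsAddCyclic G ∧ CyclicShape (2 * r) r S := by
  have hr := h.two_le
  have hs0 := h.sum_ne_zero
  have hij : i + j = 2 * r := by
    have := congrArg Multiset.card hS
    rw [h.card_eq] at this
    simpa using this.symm
  have hne := fun k hk hkr => h.nsmul_ne_of_lt h2 hi hj hS (k := k) hk hkr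
  have hjodd := h.odd_count h2 hS
  have hiodd := h.odd_count h2 (swap_terms h2 hS)
  have hSS : S.sum + S.sum = 0 := by rw [← two_nsmul, h2]
  have hord : addOrderOf x = 2 * r := by
    rw [addOrderOf_eq_iff (by omega)]
    refine ⟨by rw [mul_smul, hx, h2], fun m hm hm0 h0 => ?_⟩
    rcases lt_trichotomy m r with hlt | rfl | hlt
    · exact (hne m hm0 hlt).1 h0
    · exact hs0 (hx ▸ h0)
    · apply (hne (m - r) (by omega) (by omega)).2
      rw [sub_nsmul x hlt.le, h0, hx, zero_add, neg_eq_iff_add_eq_zero, hSS]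
  have htop : AddSubgroup.zmultiples x = ⊤ :=
    zmultiples_eq_top_of_addOrderOf (by rw [hord, h.card_group])
  refine ⟨isAddCyclic_of_zmultiples_eq_top htop, ?_⟩
  have gen : ∀ g : G, x ∈ AddSubgroup.zmultiples g → AddSubgroup.zmultiples g = ⊤ :=
    fun g hg => by
      rw [eq_top_iff, ← htop]
      exact AddSubgroup.zmultiples_le_of_mem hg
  have e1 : 2 * r / 2 = r := by omega
  have e2 : (2 * r + 2) / 2 = r + 1 := by omega
  have e3 : (2 * r + 4) / 2 = r + 2 := by omega
  by_cases hle : j ≤ i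
  · refine ⟨x, htop, Or.inr (Or.inr (Or.inr (Or.inr ⟨⟨r, by omega⟩, e1.symm, i - r, ?_, ?_, ?_⟩)))⟩
    · simp only [Set.mem_Icc]; omega
    · rwa [e1, show r - (i - r) = j by omega]
    · rw [e1, e2, show r - (i - r) = j by omega, show r + (i - r) = i by omega, succ_nsmul, hx,
        add_comm S.sum]
      exact hS
  rcases Nat.even_or_odd' r with ⟨p, hp | hp⟩
  · have hrg : r • (x + S.sum) = S.sum := by
      rw [smul_add, hx, hp, mul_comm, mul_smul, h2, smul_zero, add_zero]
    refine ⟨x + S.sum, gen _ ?_, Or.inr (Or.inr (Or.inr (Or.inr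
      ⟨⟨r, by omega⟩, e1.symm, j - r, ?_, ?_, ?_⟩)))⟩
    · have := sub_mem (AddSubgroup.mem_zmultiples (x + S.sum))
        (AddSubgroup.nsmul_mem_zmultiples (x + S.sum) r)
      rwa [hrg, add_sub_cancel_right] at this
    · simp only [Set.mem_Icc]; omega
    · rwa [e1, show r - (j - r) = i by omega]
    · rw [e1, e2, show r - (j - r) = i by omega, show r + (j - r) = j by omega, succ_nsmul, hrg,
        add_comm S.sum]
      exact swap_terms h2 hS
  -- The halves (p + 1)x and (p + 1)x + s differ by s, and r·s = s for odd r; so exactly one of them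
  -- satisfies r·g = s.
  · obtain ⟨g, hg2, hgr⟩ : ∃ g : G, 2 • g = x + S.sum ∧ r • g = S.sum := by
      have h20 : 2 • ((p + 1) • x) = x + S.sum := by
        rw [smul_smul, show 2 * (p + 1) = r + 1 by omega, succ_nsmul, hx, add_comm]
      have hr0 : r • ((p + 1) • x) = (p + 1) • S.sum := by rw [smul_comm, hx]
      have hrs : r • S.sum = S.sum := by
        rw [hp, succ_nsmul, mul_comm, mul_smul, h2, smul_zero, zero_add]
      rcases Nat.even_or_odd' (p + 1) with ⟨e, he | he⟩
      · refine ⟨(p + 1) • x + S.sum, by rw [smul_add, h20, h2, add_zero], ?_⟩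
        rw [smul_add, hr0, he, mul_comm, mul_smul, h2, smul_zero, zero_add, hrs]
      · refine ⟨(p + 1) • x, h20, ?_⟩
        rw [hr0, he, succ_nsmul, mul_comm, mul_smul, h2, smul_zero, zero_add]
    refine ⟨g, gen _ ?_, Or.inr (Or.inr (Or.inr (Or.inl ⟨?_, e1.symm, j - r, ?_, ?_, ?_⟩)))⟩
    · have := sub_mem (AddSubgroup.nsmul_mem_zmultiples g 2) (AddSubgroup.nsmul_mem_zmultiples g r)
      rwa [hg2, hgr, add_sub_cancel_right] at this
    · unfold Nat.ModEq; omega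
    · simp only [Set.mem_Icc]; omega
    · obtain ⟨a, ha⟩ := hjodd
      exact ⟨a - p, by omega⟩
    · rw [e1, e3, show r - (j - r) = i by omega, show r + (j - r) = j by omega, add_nsmul, hg2, hgr,
        add_comm S.sum]
      exact swap_terms h2 hS

variable [DecidableEq G]

theorem shape_of_replicate_add_singleton (h : BalancedConfig r S) {x u : G}
    (hS : S = Multiset.replicate (2 * r - 1) x + {u}) (hx : r • x = 0) :
    (¬ IsAddCyclic G → NoncyclicShape (2 * r) r S) ∧ (IsAddCyclic G → CyclicShape (2 * r) r S) := by
  have hr := h.two_le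
  have hrep : ∀ k ≤ 2 * r - 1, Multiset.replicate k x ≤ S := fun k hk => by
    rw [hS]
    exact ((Multiset.replicate_le_replicate x).2 hk).trans (Multiset.le_add_right _ _)
  have hord : addOrderOf x = r := by
    have h1 := addOrderOf_pos x
    have h2 := Nat.le_of_dvd (by omega) (addOrderOf_dvd_of_nsmul_eq_zero hx)
    have := h.card_of_sum _ (hrep (addOrderOf x) (by omega))
      (by rw [← Multiset.card_pos]; simpa using h1) (by simp [addOrderOf_nsmul_eq_zero])
    simpa using this
  -- If u = c·x, then x^(r-c) u is zero-sum, so c = 1 by length; but then S = x^(2r) is zero-sum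
  -- too.
  have hu : u ∉ AddSubgroup.zmultiples x := by
    intro hu
    rw [mem_zmultiples_iff_mem_range_addOrderOf, hord] at hu
    simp only [Finset.mem_image, Finset.mem_range] at hu
    obtain ⟨c, hc, rfl⟩ := hu
    have hle : Multiset.replicate (r - c) x + {c • x} ≤ S := by
      rw [hS]
      exact add_le_add_left ((Multiset.replicate_le_replicate x).2 (by omega)) _
    have hcard := h.card_of_sum _ hle (by rw [← Multiset.card_pos]; simp) (by
      rw [Multiset.sum_add, Multiset.sum_replicate, Multiset.sum_singleton, ← add_nsmul,
        Nat.sub_add_cancel hc.le, hx])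
    simp only [Multiset.card_add, Multiset.card_replicate, Multiset.card_singleton] at hcard
    obtain rfl : c = 1 := by omega
    apply h.sum_ne_zero
    rw [hS, Multiset.sum_add, Multiset.sum_replicate, Multiset.sum_singleton, ← add_nsmul,
      show 2 * r - 1 + 1 = 2 * r by omega, mul_smul, hx, smul_zero]
  have hcard := h.card_group
  rcases exists_half_or_exists_two_torsion hcard hord hu with ⟨g, hg, hgx⟩ | ⟨hev, y, hy2, hyx⟩
  · have htop : AddSubgroup.zmultiples g = ⊤ := by
      rw [eq_top_iff]
      intro y _
      have hxg : AddSubgroup.zmultiples x ≤ AddSubgroup.zmultiples g :=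
        AddSubgroup.zmultiples_le_of_mem (by
          rw [← hg]; exact AddSubgroup.nsmul_mem_zmultiples g 2)
      rcases mem_or_add_mem_zmultiples hcard hord hgx y with h1 | h1
      · exact hxg h1
      · simpa using sub_mem (hxg h1) (AddSubgroup.mem_zmultiples g)
    refine ⟨fun hnc => absurd (isAddCyclic_of_zmultiples_eq_top htop) hnc, fun _ =>
      ⟨g, htop, Or.inr (Or.inl ⟨u, ?_, ?_⟩)⟩⟩
    · rwa [hg]
    · rw [hg, hS]; rfl
  · obtain ⟨m, hm⟩ := hev
    obtain ⟨h1, h2, h3, h4⟩ := noncyclic_of_addOrderOf (m := m) (by omega) (by omega) hy2 hyx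
    refine ⟨fun _ => ⟨m, x, y, by omega, by omega, by omega, by omega, h1, hyx, h2, h3,
      Or.inl ⟨u, hu, ?_⟩⟩, fun hc => absurd hc h4⟩
    rw [hS]; rfl

/-- The third alternative of `NoncyclicShape` is never needed: h + mg has order 2 and lies outside
⟨g⟩ whenever h does, which reduces it to the second. -/
theorem noncyclicShape_of_nsmul_eq_zero (h : BalancedConfig r S) (h2 : 2 • S.sum = 0) {x : G}
    {i j : ℕ} (hj : 1 ≤ j) (hji : j < i)
    (hS : S = Multiset.replicate i x + Multiset.replicate j (x + S.sum)) (hx : r • x = 0)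
    (hr2 : Even r) : ¬ IsAddCyclic G ∧ NoncyclicShape (2 * r) r S := by
  have hr := h.two_le
  have hcard := h.card_group
  have hij : i + j = 2 * r := by
    have := congrArg Multiset.card hS
    rw [h.card_eq] at this
    simpa using this.symm
  have hne := fun k hk hkr => h.nsmul_ne_of_lt h2 (by omega) hj hS (k := k) hk hkr
  have hjodd := h.odd_count h2 hS
  have hord : addOrderOf x = r := by
    rw [addOrderOf_eq_iff (by omega)]
    exact ⟨hx, fun m hm hm0 => (hne m hm0 hm).1⟩
  have hs : S.sum ∉ AddSubgroup.zmultiples x := by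
    intro hmem
    rw [mem_zmultiples_iff_mem_range_addOrderOf, hord] at hmem
    simp only [Finset.mem_image, Finset.mem_range] at hmem
    obtain ⟨c, hc, hcx⟩ := hmem
    rcases Nat.eq_zero_or_pos c with rfl | hc0
    · exact h.sum_ne_zero (by rw [← hcx, zero_nsmul])
    · exact (hne c hc0 hc).2 hcx
  obtain ⟨m, hm⟩ := hr2
  obtain ⟨h1, h3, h4, h5⟩ := noncyclic_of_addOrderOf (m := m) (by omega) (by omega) h2 hs
  have e1 : 2 * r / 2 = r := by omega
  refine ⟨h5, m, x, S.sum, by omega, e1.symm, by omega, by omega, h1, hs, h3, h4,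
    Or.inr (Or.inl ⟨i - r, ?_, ?_, ?_⟩)⟩
  · simp only [Set.mem_Icc]; omega
  · rw [Nat.odd_iff] at *; omega
  · rw [e1, show r - (i - r) = j by omega, show r + (i - r) = i by omega, add_comm S.sum]
    exact hS

theorem shape (h : BalancedConfig r S) {T : Multiset G} (hT : T ≤ S) (hT0 : T.sum = 0)
    (hne : T ≠ 0) :
    (¬ IsAddCyclic G → NoncyclicShape (2 * r) r S) ∧ (IsAddCyclic G → CyclicShape (2 * r) r S) := by
  by_cases h2 : 2 • S.sum = 0
  · have ofCyc : IsAddCyclic G ∧ CyclicShape (2 * r) r S →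
        (¬ IsAddCyclic G → NoncyclicShape (2 * r) r S) ∧
        (IsAddCyclic G → CyclicShape (2 * r) r S) :=
      fun hc => ⟨fun hn => absurd hc.1 hn, fun _ => hc.2⟩
    have ofNon : ¬ IsAddCyclic G ∧ NoncyclicShape (2 * r) r S →
        (¬ IsAddCyclic G → NoncyclicShape (2 * r) r S) ∧
        (IsAddCyclic G → CyclicShape (2 * r) r S) :=
      fun hc => ⟨fun _ => hc.2, fun hn => absurd hn hc.1⟩
    obtain ⟨x, i, j, hi, hj, hS, hx⟩ := h.eq_replicate_add_replicate h2 hT hT0 hne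
    have hS' := swap_terms h2 hS
    rcases hx with hx | hx
    · rcases Nat.even_or_odd r with hr | hr
      · have hrs : r • (x + S.sum) = 0 := by
          obtain ⟨p, rfl⟩ := hr
          rw [smul_add, hx, ← two_mul, mul_comm, mul_smul, h2, smul_zero, add_zero]
        have hij : i + j = 2 * r := by
          have := congrArg Multiset.card hS
          rw [h.card_eq] at this
          simpa using this.symm
        have hjodd := h.odd_count h2 hS
        rcases lt_trichotomy j i with hlt | heq | hlt
        · exact ofNon (h.noncyclicShape_of_nsmul_eq_zero h2 hj hlt hS hx hr)
        · rw [Nat.odd_iff] at hjodd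
          rw [Nat.even_iff] at hr
          omega
        · exact ofNon (h.noncyclicShape_of_nsmul_eq_zero h2 hi hlt hS' hrs hr)
      -- For r odd, r(x + s) = s, so interchanging the two terms leads back to the cyclic case.
      · refine ofCyc (h.cyclicShape_of_nsmul_eq_sum h2 hj hi hS' ?_)
        obtain ⟨p, hp⟩ := hr
        rw [smul_add, hx, zero_add, hp, succ_nsmul, mul_comm, mul_smul, h2, smul_zero, zero_add]
    · exact ofCyc (h.cyclicShape_of_nsmul_eq_sum h2 hi hj hS hx)
  · obtain ⟨x, u, hS, hx⟩ := h.eq_replicate_add_singleton h2 hT hT0 hne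
    exact h.shape_of_replicate_add_singleton hS hx

end BalancedConfig

/-! ### Assembly of the cases -/

theorem ncard_seqSupp_twoTermSeq_le {G : Type*} (a b : G) (k l : ℕ) :
    (seqSupp (twoTermSeq a k b l)).ncard ≤ 2 := by
  refine (Set.ncard_le_ncard (t := {a, b}) ?_ (Set.toFinite _)).trans
    (Set.ncard_insert_le a {b} |>.trans (by simp))
  intro x hx
  rcases Multiset.mem_add.1 (show x ∈ Multiset.replicate k a + Multiset.replicate l b from hx)
    with h | h
  · exact Or.inl (Multiset.eq_of_mem_replicate h)
  · exact Or.inr (Multiset.eq_of_mem_replicate h)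

section

variable {G : Type*} [AddCommGroup G]

theorem CyclicShape.ncard_le {n r : ℕ} {S : Multiset G} (h : CyclicShape n r S) :
    (seqSupp S).ncard ≤ 2 := by
  obtain ⟨g, -, ⟨g', rfl⟩ | ⟨g', -, rfl⟩ | ⟨-, -, rfl⟩ | ⟨-, -, x, -, -, rfl⟩ |
    ⟨-, -, x, -, -, rfl⟩⟩ := h <;> exact ncard_seqSupp_twoTermSeq_le _ _ _ _

theorem NoncyclicShape.ncard_le {n r : ℕ} {S : Multiset G} (h : NoncyclicShape n r S) :
    (seqSupp S).ncard ≤ 2 := by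
  obtain ⟨m, g, h, -, -, -, -, -, -, -, -, ⟨g', -, rfl⟩ | ⟨x, -, -, rfl⟩ | ⟨x, -, -, rfl⟩⟩ := h <;>
    exact ncard_seqSupp_twoTermSeq_le _ _ _ _

theorem exists_maximal_zeroSumFree (S : Multiset G) :
    ∃ W ≤ S, ZeroSumFree W ∧ ∀ V ≤ S, Multiset.card W < Multiset.card V → ¬ ZeroSumFree V := by
  classical
  obtain ⟨W, hW, hmax⟩ := Finset.exists_max_image
    (S.powerset.toFinset.filter fun V => ZeroSumFree V) Multiset.card
    ⟨0, by
      simp only [Finset.mem_filter, Multiset.mem_toFinset, Multiset.mem_powerset]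
      exact ⟨Multiset.zero_le _, fun T hT _ => by simpa using hT⟩⟩
  simp only [Finset.mem_filter, Multiset.mem_toFinset, Multiset.mem_powerset] at hW hmax
  exact ⟨W, hW.1, hW.2, fun V hV hlt hf => by have := hmax V ⟨hV, hf⟩; omega⟩

variable [Finite G]

theorem cyclicShape_of_card_le_two {n r : ℕ} {S : Multiset G} (hn : Nat.card G = n)
    (hS : Multiset.card S = n) (H : ∀ T ≤ S, T ≠ 0 → T.sum = 0 → Multiset.card T = r)
    (hn2 : n ≤ 2) : IsAddCyclic G ∧ CyclicShape n r S := by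
  have hpos := Nat.card_pos (α := G)
  suffices ∃ g g' : G, AddSubgroup.zmultiples g = ⊤ ∧ S = twoTermSeq g (n - 1) g' 1 by
    obtain ⟨g, g', htop, h⟩ := this
    exact ⟨isAddCyclic_of_zmultiples_eq_top htop, g, htop, Or.inl ⟨g', h⟩⟩
  obtain rfl | rfl : n = 1 ∨ n = 2 := by omega
  · obtain ⟨a, rfl⟩ := Multiset.card_eq_one.1 hS
    have := (Nat.card_eq_one_iff_unique.1 hn).1
    exact ⟨a, a, Subsingleton.elim _ _, by simp [twoTermSeq]⟩
  · obtain ⟨a, b, rfl⟩ := Multiset.card_eq_two.1 hS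
    have : Fact (Nat.Prime 2) := ⟨Nat.prime_two⟩
    have htop : ∀ g : G, g ≠ 0 → AddSubgroup.zmultiples g = ⊤ := fun g hg =>
      zmultiples_eq_top_of_prime_card hn hg
    by_cases ha : a = 0
    · have hb : b ≠ 0 := by
        rintro rfl
        subst ha
        have h1 := H {0} (by simp) (by simp) (by simp)
        have h2 := H {0, 0} le_rfl (by simp) (by simp)
        simp at h1 h2
        omega
      exact ⟨b, a, htop b hb, Multiset.pair_comm a b⟩
    · exact ⟨a, b, htop a ha, by simp [twoTermSeq]⟩

theorem shape_of_unique_length [DecidableEq G] {n r : ℕ} {S T : Multiset G}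
    (hn : Nat.card G = n) (hS : Multiset.card S = n)
    (H : ∀ T ≤ S, T ≠ 0 → T.sum = 0 → Multiset.card T = r) (hT : T ≤ S) (hTne : T ≠ 0)
    (hT0 : T.sum = 0) :
    (¬ IsAddCyclic G → NoncyclicShape n r S) ∧ (IsAddCyclic G → CyclicShape n r S) := by
  have ofCyc : IsAddCyclic G ∧ CyclicShape n r S →
      (¬ IsAddCyclic G → NoncyclicShape n r S) ∧ (IsAddCyclic G → CyclicShape n r S) :=
    fun hc => ⟨fun hn => absurd hc.1 hn, fun _ => hc.2⟩
  by_cases hn2 : n ≤ 2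
  · exact ofCyc (cyclicShape_of_card_le_two hn hS H hn2)
  have hTc := H T hT hTne hT0
  have hr : 0 < r := by rw [← hTc]; exact Multiset.card_pos.2 hTne
  obtain ⟨U, hU⟩ := Multiset.le_iff_exists_add.1 hT
  have hUc : Multiset.card U + r = n := by
    have := congrArg Multiset.card hU
    rw [Multiset.card_add] at this
    omega
  obtain ⟨W, hWS, hW, hmax⟩ := exists_maximal_zeroSumFree S
  have hWn := hW.card_lt
  have hUW : Multiset.card U ≤ Multiset.card W := by
    by_contra! hlt
    refine hmax U (Multiset.le_iff_exists_add.2 ⟨T, by rw [add_comm, hU]⟩) hlt fun A hA hA0 => ?_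
    by_contra hne
    have h1 := H (T + A) (by rw [hU]; exact add_le_add_right hA T)
      (by rw [← Multiset.card_pos, Multiset.card_add]; omega) (by simp [hT0, hA0])
    have h2 := Multiset.card_pos.2 hne
    rw [Multiset.card_add] at h1
    omega
  have hrW : r ≤ Multiset.card W ∨ Multiset.card W + 1 = n := by
    by_contra! hcon
    obtain ⟨hlt, hne⟩ := hcon
    have hall : ∀ u ∈ U, ∀ x ∈ T, u = x := by
      intro u hu x hx
      have hle : T.erase x + {u} ≤ S := by
        rw [hU]
        exact add_le_add (Multiset.erase_le _ _) (by simpa using hu)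
      have hcard : Multiset.card (T.erase x + {u}) = r := by
        rw [Multiset.card_add, Multiset.card_singleton, Multiset.card_erase_add_one hx, hTc]
      have hnf := hmax _ hle (by omega)
      unfold ZeroSumFree at hnf
      push Not at hnf
      obtain ⟨A, hA, hA0, hAne⟩ := hnf
      have hAc := H A (hA.trans hle) hAne hA0
      have hAe : A = T.erase x + {u} := Multiset.eq_of_le_of_card_le hA (by omega)
      rw [hAe, Multiset.sum_add, Multiset.sum_singleton] at hA0
      have hx' := Multiset.sum_erase hx
      rw [hT0] at hx'
      rw [eq_neg_of_add_eq_zero_right hx'] at hA0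
      exact (neg_add_eq_zero.1 hA0).symm
    obtain ⟨x, hx⟩ := Multiset.exists_mem_of_ne_zero hTne
    have hrn : r ≠ n := by
      rintro rfl
      have hfree : ZeroSumFree (T.erase x) := by
        intro A hA hA0
        by_contra hAne
        have h1 := H A ((hA.trans (Multiset.erase_le _ _)).trans hT) hAne hA0
        have h2 := Multiset.card_le_card hA
        have h3 := Multiset.card_erase_add_one hx
        omega
      refine hmax _ ((Multiset.erase_le x T).trans hT) ?_ hfree
      have := Multiset.card_erase_add_one hx
      omega
    obtain ⟨u, hu⟩ := Multiset.card_pos_iff_exists_mem.1 (by omega : 0 < Multiset.card U)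
    have hSu : S = Multiset.replicate n u := by
      refine Multiset.eq_replicate.2 ⟨hS, fun z hz => ?_⟩
      rw [hU] at hz
      rcases Multiset.mem_add.1 hz with hz | hz
      · exact (hall u hu z hz).symm
      · rw [hall z hz x hx, hall u hu x hx]
    have := H S le_rfl (by rw [← Multiset.card_pos]; omega) (by
      rw [hSu, Multiset.sum_replicate, ← hn, card_nsmul_eq_zero'])
    omega
  by_cases hW1 : Multiset.card W + 1 = n
  · obtain ⟨g, hg, hord⟩ := hW.eq_replicate_of_card (by omega) (by omega)
    have htop := zmultiples_eq_top_of_addOrderOf hord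
    obtain ⟨B, hB⟩ := Multiset.le_iff_exists_add.1 hWS
    have hBc : Multiset.card B = 1 := by
      have := congrArg Multiset.card hB
      rw [Multiset.card_add] at this
      omega
    obtain ⟨b, rfl⟩ := Multiset.card_eq_one.1 hBc
    refine ofCyc ⟨isAddCyclic_of_zmultiples_eq_top htop, g, htop, Or.inl ⟨b, ?_⟩⟩
    rw [hB, hg, show Multiset.card W = n - 1 by omega]
    rfl
  have hrW' : r ≤ Multiset.card W := hrW.resolve_right hW1
  by_cases hlong : n + 1 ≤ 2 * Multiset.card W
  · exact ofCyc (cyclicShape_of_long_zeroSumFree hn hS H hWS hW hmax hlong (by omega) (by omega)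
      hrW')
  -- The inequalities n - r ≤ |W|, r ≤ |W| and 2|W| ≤ n leave only |W| = r = n/2.
  · obtain rfl : n = 2 * r := by omega
    have hconf : BalancedConfig r S :=
      ⟨by omega, hn, hS, H, fun V hV hlt => hmax V hV (by omega)⟩
    exact hconf.shape hT hT0 hTne

end

theorem mainTheorem1 {G : Type*} [AddCommGroup G] [Finite G] (n : ℕ) (hn : Nat.card G = n)
    (S : Multiset G) (hS : Multiset.card S = n)
    (r : ℕ) (hr : r ∈ Set.Icc 1 n) (hr0 : (0 : G) ∈ subseqSums r S)
    (hr_unique : ∀ k ∈ Set.Icc 1 n, (0 : G) ∈ subseqSums k S → k = r) :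
    (seqSupp S).ncard ≤ 2 ∧
    (¬ IsAddCyclic G →
      ∃ (m : ℕ) (g h : G),
        n = 4 * m ∧ r = n / 2 ∧ r = 2 * m ∧
        addOrderOf g = n / 2 ∧ addOrderOf h = 2 ∧ h ∉ AddSubgroup.zmultiples g ∧
        IsCompl (AddSubgroup.zmultiples h) (AddSubgroup.zmultiples g) ∧
        Nonempty (G ≃+ ZMod 2 × ZMod (2 * m)) ∧
        ((∃ g' : G, g' ∉ AddSubgroup.zmultiples g ∧ S = twoTermSeq g (n - 1) g' 1) ∨
         (∃ x ∈ Set.Icc 1 (n / 2 - 1), Odd x ∧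
            S = twoTermSeq g (n / 2 + x) (h + g) (n / 2 - x)) ∨
         (∃ x ∈ Set.Icc 1 (n / 2 - 1), Odd x ∧
            S = twoTermSeq g (n / 2 + x) (h + ((n + 4) / 4) • g) (n / 2 - x)))) ∧
    (IsAddCyclic G →
      ∃ g : G, AddSubgroup.zmultiples g = ⊤ ∧
        ((∃ g' : G, S = twoTermSeq g (n - 1) g' 1) ∨
         (∃ g'' : G, g'' ∉ AddSubgroup.zmultiples (2 • g) ∧
            S = twoTermSeq (2 • g) (n - 1) g'' 1) ∨
         (Odd n ∧ r = (n + 1) / 2 ∧ S = twoTermSeq g (n - 2) (((n + 1) / 2) • g) 2) ∨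
         (n ≡ 2 [MOD 4] ∧ r = n / 2 ∧ ∃ x ∈ Set.Icc 0 (n / 2 - 1), Even x ∧
            S = twoTermSeq (2 • g) (n / 2 + x) (((n + 4) / 2) • g) (n / 2 - x)) ∨
         (Even n ∧ r = n / 2 ∧ ∃ x ∈ Set.Icc 0 (n / 2 - 1), Odd (n / 2 - x) ∧
            S = twoTermSeq g (n / 2 + x) (((n + 2) / 2) • g) (n / 2 - x)))) := by
  classical
  have H : ∀ T ≤ S, T ≠ 0 → T.sum = 0 → Multiset.card T = r := fun T hT hne h0 =>
    hr_unique _ ⟨Multiset.card_pos.2 hne, (Multiset.card_le_card hT).trans hS.le⟩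
      ⟨T, hT, rfl, h0⟩
  obtain ⟨T, hT, hTc, hT0⟩ := hr0
  have hTne : T ≠ 0 := by
    rw [← Multiset.card_pos, hTc]
    exact hr.1
  obtain ⟨h1, h2⟩ := shape_of_unique_length hn hS H hT hTne hT0
  refine ⟨?_, h1, h2⟩
  by_cases hc : IsAddCyclic G
  · exact (h2 hc).ncard_le
  · exact (h1 hc).ncard_le
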